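/- Work over $\mathbb{C}$ and count operations in the non-uniform arithmetic circuit model: a circuit may use the input variables and arbitrary complex constants free of charge, and each operation $+,-,\times$ costs one. Let $\omega$ be the exponent of matrix multiplication, i.e. the infimum of all real $\beta$ such that $n\times n$ complex matrices can be multiplied with $O(n^{\beta})$ operations. For a finite group $G$ and a complete set $\mathrm{Irr}(G)$ of irreducible complex matrix representations of $G$ (one for each isomorphism class, in any basis), the generalized DFT of $G$ with respect to $\mathrm{Irr}(G)$ is the linear map $$\mathbb{C}[G]\ni c\;\longmapsto\;\sum_{g\in G}c_g\bigoplus_{\rho\in\mathrm{Irr}(G)}\rho(g),$$ whose output is given by the entries of the diagonal blocks. Theorem 5.1. For every $\varepsilon>0$ there is a constant $C_\varepsilon$, independent of the group, such that the following holds. Let $G$ be a finite group and let $H_1,H_2,H_3$ be subgroups of $G$, each of which is abelian or a $p$-group (for some prime $p$, which may depend on the subgroup). Suppose that $H_1H_2$ is a subgroup of $G$, that $H_1\cap H_2=\{1\}$, and that $H_1H_2\cap H_3=\{1\}$. Then $G$ has a complete set of irreducible complex matrix representations, and for every such set the generalized DFT of $G$ can be computed with at most $$C_\varepsilon\,|G|^{\omega/2+\varepsilon}\cdot\frac{|G|\log_2|G|}{|H_1|\,|H_2|\,|H_3|}$$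 operations. -/

import Mathlib

open scoped Pointwise

/-! ### Arithmetic circuits -/

/-- The arithmetic operations of a circuit. -/
inductive ArithOp where
  | add
  | sub
  | mul

/-- The effect of an arithmetic operation. -/
def ArithOp.eval {K : Type*} [Field K] : ArithOp → K → K → K
  | .add, a, b => a + b
  | .sub, a, b => a - b
  | .mul, a, b => a * b

/-- What a gate (or an output) of a circuit may refer to once `s` gates have been placed: one of
the input variables (indexed by `ι`), a constant of the field, or one of the `s` gates. -/
inductive Operand (K ι : Type*) (s : ℕ) where
  | input (i : ι)
  | const (a : K)
  | gate (j : Fin s)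

/-- The value of an operand, when the inputs have the values `x` and the gates the values `v`. -/
def Operand.eval {K ι : Type*} {s : ℕ} (x : ι → K) (v : Fin s → K) : Operand K ι s → K
  | .input i => x i
  | .const a => a
  | .gate j => v j

/-- Arithmetic circuits (straight-line programs) over `K` with input variables indexed by `ι` and
exactly `s` gates. The gates are listed in order; each performs one arithmetic operation on two
operands, which are inputs, constants, or earlier gates. -/
inductive Circuit (K ι : Type*) : ℕ → Type _ where
  | nil : Circuit K ι 0
  | snoc {s : ℕ} (c : Circuit K ι s) (op : ArithOp) (a b : Operand K ι s) : Circuit K ι (s + 1)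

/-- The values of the gates of a circuit on the input `x`. -/
def Circuit.eval {K ι : Type*} [Field K] (x : ι → K) : {s : ℕ} → Circuit K ι s → Fin s → K
  | _, .nil => Fin.elim0
  | _, .snoc c op a b =>
      Fin.snoc (α := fun _ => K) (c.eval x) (op.eval (a.eval x (c.eval x)) (b.eval x (c.eval x)))

/-- The map `F : K^ι → K^κ` can be computed by an arithmetic circuit with at most `T` operations.
Inputs and constants are free of charge; each of the operations `+`, `-`, `*` costs one. -/
def ComputableWithin {K ι κ : Type*} [Field K] (F : (ι → K) → κ → K) (T : ℝ) : Prop :=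
  ∃ s : ℕ, (s : ℝ) ≤ T ∧ ∃ (c : Circuit K ι s) (out : κ → Operand K ι s),
    ∀ (x : ι → K) (k : κ), (out k).eval x (c.eval x) = F x k

/-! ### The exponent of matrix multiplication -/

/-- Multiplication of two `n × n` complex matrices, as a map from the `2n²` entries of the
factors to the `n²` entries of the product. -/
def matMulMap (n : ℕ) (x : (Fin n × Fin n) ⊕ (Fin n × Fin n) → ℂ) (p : Fin n × Fin n) : ℂ :=
  ((Matrix.of fun i j => x (Sum.inl (i, j))) * (Matrix.of fun i j => x (Sum.inr (i, j))) :
    Matrix (Fin n) (Fin n) ℂ) p.1 p.2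

/-- The exponent `ω` of matrix multiplication: the infimum of all real `β` such that
`n × n` matrices can be multiplied with `O(n ^ β)` arithmetic operations. -/
noncomputable def matMulExponent : ℝ :=
  sInf {β : ℝ | ∃ b : ℝ, ∀ n : ℕ, 1 ≤ n → ComputableWithin (matMulMap n) (b * (n : ℝ) ^ β)}

/-! ### Irreducible representations and the generalized discrete Fourier transform -/

/-- The representation on `ℂ^d` defined by a homomorphism into the `d × d` matrices. -/
noncomputable def matrixRep {G : Type*} [Group G] {d : ℕ} (ρ : G →* Matrix (Fin d) (Fin d) ℂ) :
    Representation ℂ G (Fin d → ℂ) :=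
  ((Matrix.toLinAlgEquiv' : Matrix (Fin d) (Fin d) ℂ ≃ₐ[ℂ] _) :
    Matrix (Fin d) (Fin d) ℂ →* Module.End ℂ (Fin d → ℂ)).comp ρ

/-- A complete set of irreducible complex matrix representations of `G`, i.e. one matrix
representation (in an arbitrary basis) for each isomorphism class of irreducible
finite-dimensional representations. -/
structure IrrSet (G : Type*) [Group G] where
  /-- the number of representations -/
  num : ℕ
  /-- their dimensions -/
  dim : Fin num → ℕ
  /-- the representations -/
  rep : ∀ i : Fin num, G →* Matrix (Fin (dim i)) (Fin (dim i)) ℂ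
  irreducible : ∀ i, (matrixRep (rep i)).IsIrreducible
  pairwise_inequivalent : ∀ i j,
    Nonempty ((matrixRep (rep i)).Equiv (matrixRep (rep j))) → i = j
  complete : ∀ (d : ℕ) (σ : G →* Matrix (Fin d) (Fin d) ℂ), (matrixRep σ).IsIrreducible →
    ∃ i, Nonempty ((matrixRep σ).Equiv (matrixRep (rep i)))

/-- The generalized DFT of the finite group `G` with respect to the complete set `R` of irreducible
representations. It sends `c ∈ ℂ[G]` to the block-diagonal matrix
`∑ g, c g • ⨁ i, R.rep i g`, given by the entries of its diagonal blocks. -/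
def groupDFT {G : Type*} [Group G] [Fintype G] (R : IrrSet G) (c : G → ℂ)
    (q : Σ i : Fin R.num, Fin (R.dim i) × Fin (R.dim i)) : ℂ :=
  (∑ g : G, c g • R.rep q.1 g) q.2.1 q.2.2

/-- The subgroup `H` is abelian, or it is a `p`-group for some prime `p`. -/
def AbelianOrPGroup {G : Type*} [Group G] (H : Subgroup G) : Prop :=
  (∀ a ∈ H, ∀ b ∈ H, a * b = b * a) ∨ ∃ p : ℕ, p.Prime ∧ IsPGroup p H

/-!
The algorithm rests on one observation. Let `K` and `H` be groups with homomorphisms to `G`, let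
`a` be a function on `K × H`, and let `ρ` be an irreducible representation of `G`. In a basis
adapted to `K` on the left and a basis adapted to `H` on the right, `∑ a (k, h) ρ(k) ρ(h)` becomes
`∑ a (k, h) A(k) S B(h)`, where `A(k)` is block diagonal with blocks `σ(k)`, `B(h)` is block
diagonal with blocks `τ(h)`, and `S` is a constant matrix. So its `(σ, τ)` blocks are obtained
from those of `S` by applying one and the same matrix, the `σ ⊗ τ` component of the transform of
`a` over `K × H`. If the columns that are multiplied by this matrix are collected, over all `ρ`,
one matrix product of size `(dim σ * dim τ) × (dim σ * dim τ) × N` results for each pair `(σ, τ)`.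
Since the squares of the dimensions of the irreducible representations add up to at most the order
of the group, all of these products and the changes of basis take `O(|G| ^ (w / 2))` operations,
where `n × n` matrices are multiplied in `O(n ^ w)` (`computableWithin_blockMul`,
`computableWithin_productSet`). Besides this, `|H|` transforms over `K` and `|K|` transforms over
`H` are needed.

The same idea, with the cyclic group generated by an element `g` in the place of `H`, handles a
group whose elements are uniquely `n * g ^ i` with `n` in a subgroup `N` and `i < p`
(`computableWithin_cyclicExtension`). Here the columns on the right are eigenvectors of `ρ(g)`,
the sum over `i` is a twisted Fourier transform of length `p`, which is done by Bluestein's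
algorithm, and an eigenvalue `l` of `ρ(g)` only meets the eigenspace of `σ(g ^ p)` for `l ^ p`. No
Clifford theory is needed. By induction along a chain of subgroups, every finite solvable group
has a transform with `O(|G| ^ (w / 2))` operations, uniformly in the group
(`exists_computableWithin_groupDFT_of_isSolvable`). This covers abelian groups and `p`-groups.

Under the hypotheses of the theorem, the elements of `K = H₁ H₂` are uniquely products of elements
of `H₁` and `H₂`, so the transform over `K` reduces to those over `H₁` and `H₂`, and then
functions supported on `K H₃` are transformed by means of `K` and `H₃`. Finally `G` is covered by
`O(|G| log |G| / |K H₃|)` left translates of `K H₃` (`exists_cover`), and translating a function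
on `G` multiplies its transform by constant matrices. That `2 ≤ ω`, so that `w > 2` in all of
this, holds since the `n ^ 2` entries of a product of matrices need different gates
(`two_le_matMulExponent`).
-/

/-! ### Building circuits -/

section Circuits

variable {K ι ι' κ κ' : Type*}

/-- Regard an operand as one of a circuit with `n` further gates. -/
def Operand.weaken {s : ℕ} (n : ℕ) : Operand K ι s → Operand K ι (s + n)
  | .input i => .input i
  | .const a => .const a
  | .gate j => .gate (Fin.castAdd n j)

/-- Substitute the operands `inp` of a circuit with `s` gates for the input variables of a second
circuit, the gates of which are placed after those `s` gates. -/
def Operand.subst {s s' : ℕ} (inp : ι' → Operand K ι s) : Operand K ι' s' → Operand K ι (s + s')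
  | .input i => (inp i).weaken s'
  | .const a => .const a
  | .gate j => .gate (Fin.natAdd s j)

/-- The circuit `c` followed by a second circuit, whose input variables are replaced by the
operands `inp` of `c`. -/
def Circuit.append {s : ℕ} (c : Circuit K ι s) (inp : ι' → Operand K ι s) :
    {s' : ℕ} → Circuit K ι' s' → Circuit K ι (s + s')
  | _, .nil => c
  | _, .snoc c' op a b => .snoc (c.append inp c') op (a.subst inp) (b.subst inp)

theorem Operand.eval_weaken {s n : ℕ} (x : ι → K) (u : Fin s → K) (v : Fin n → K)
    (o : Operand K ι s) : (o.weaken n).eval x (Fin.append u v) = o.eval x u := by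
  cases o <;> simp [Operand.weaken, Operand.eval]

theorem Operand.eval_subst {s n : ℕ} (x : ι → K) (u : Fin s → K) (v : Fin n → K)
    (inp : ι' → Operand K ι s) (o : Operand K ι' n) :
    (o.subst inp).eval x (Fin.append u v) = o.eval (fun i => (inp i).eval x u) v := by
  cases o with
  | input i => exact Operand.eval_weaken x u v (inp i)
  | const a => rfl
  | gate j => exact Fin.append_right u v j

variable [Field K]

theorem Circuit.eval_append {s : ℕ} (x : ι → K) (c : Circuit K ι s) (inp : ι' → Operand K ι s)
    {s' : ℕ} (c' : Circuit K ι' s') :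
    (c.append inp c').eval x =
      Fin.append (c.eval x) (c'.eval fun i => (inp i).eval x (c.eval x)) := by
  induction c' with
  | nil =>
    funext i
    exact (Fin.append_left (c.eval x) _ i).symm
  | snoc c' op a b ih =>
    simp only [Circuit.append, Circuit.eval, ih, Operand.eval_subst]
    exact (Fin.append_snoc _ _ _).symm

namespace ComputableWithin

theorem mono {F : (ι → K) → κ → K} {T T' : ℝ} (h : ComputableWithin F T) (hT : T ≤ T') :
    ComputableWithin F T' := by
  obtain ⟨s, hs, h⟩ := h
  exact ⟨s, hs.trans hT, h⟩

theorem congr {F F' : (ι → K) → κ → K} {T T' : ℝ} (h : ComputableWithin F T)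
    (hF : ∀ x k, F x k = F' x k) (hT : T ≤ T') : ComputableWithin F' T' := by
  obtain rfl : F = F' := funext fun x => funext fun k => hF x k
  exact h.mono hT

theorem nonneg {F : (ι → K) → κ → K} {T : ℝ} (h : ComputableWithin F T) : 0 ≤ T := by
  obtain ⟨s, hs, -⟩ := h
  exact le_trans (Nat.cast_nonneg s) hs

/-- Outputs that are inputs or constants are free. -/
theorem of_operand {F : (ι → K) → κ → K} (o : κ → Operand K ι 0)
    (h : ∀ x k, (o k).eval x Fin.elim0 = F x k) : ComputableWithin F 0 :=
  ⟨0, by simp, .nil, o, h⟩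

theorem proj (f : κ → ι) : ComputableWithin (fun (x : ι → K) k => x (f k)) 0 :=
  of_operand (fun k => .input (f k)) fun _ _ => rfl

theorem const (c : κ → K) : ComputableWithin (fun (_ : ι → K) k => c k) 0 :=
  of_operand (fun k => .const (c k)) fun _ _ => rfl

theorem proj_ite (p : κ → Prop) [DecidablePred p] (f : κ → ι) :
    ComputableWithin (fun (x : ι → K) k => if p k then x (f k) else 0) 0 := by
  refine of_operand (fun k => if p k then .input (f k) else .const 0) fun x k => ?_
  by_cases h : p k <;> simp [h, Operand.eval]

theorem reindex {F : (ι → K) → κ → K} {T : ℝ} (h : ComputableWithin F T) (f : κ' → κ) :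
    ComputableWithin (fun x k => F x (f k)) T := by
  obtain ⟨s, hs, c, out, h⟩ := h
  exact ⟨s, hs, c, fun k => out (f k), fun x k => h x (f k)⟩

theorem comp {F : (ι → K) → κ → K} {F' : (κ → K) → κ' → K} {T T' : ℝ}
    (h : ComputableWithin F T) (h' : ComputableWithin F' T') :
    ComputableWithin (fun x => F' (F x)) (T + T') := by
  obtain ⟨s, hs, c, out, h⟩ := h
  obtain ⟨s', hs', c', out', h'⟩ := h'
  refine ⟨s + s', by push_cast; linarith, c.append out c', fun k => (out' k).subst out,
    fun x k => ?_⟩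
  rw [Circuit.eval_append, Operand.eval_subst, h']
  simp only [h]

theorem sumElim {F : (ι → K) → κ → K} {F' : (ι → K) → κ' → K} {T T' : ℝ}
    (h : ComputableWithin F T) (h' : ComputableWithin F' T') :
    ComputableWithin (fun x => Sum.elim (F x) (F' x)) (T + T') := by
  obtain ⟨s, hs, c, out, h⟩ := h
  obtain ⟨s', hs', c', out', h'⟩ := h'
  refine ⟨s + s', by push_cast; linarith, c.append .input c',
    Sum.elim (fun k => (out k).weaken s') fun k => (out' k).subst .input, fun x k => ?_⟩
  rw [Circuit.eval_append]
  cases k with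
  | inl k => exact (Operand.eval_weaken ..).trans (h x k)
  | inr k => exact (Operand.eval_subst ..).trans (h' x k)

/-- A finite family of maps can be computed one after the other. -/
theorem sigma {A : Type*} [Fintype A] {κ : A → Type*} {F : ∀ a, (ι → K) → κ a → K} {T : A → ℝ}
    (h : ∀ a, ComputableWithin (F a) (T a)) :
    ComputableWithin (fun x (q : Σ a, κ a) => F q.1 x q.2) (∑ a, T a) := by
  classical
  have key : ∀ s : Finset A,
      ComputableWithin (fun x (q : Σ a, κ a) => if q.1 ∈ s then F q.1 x q.2 else 0)
        (∑ a ∈ s, T a) := by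
    intro s
    induction s using Finset.induction_on with
    | empty => simpa using const (ι := ι) (fun _ : Σ a, κ a => (0 : K))
    | insert a s ha ih =>
      rw [Finset.sum_insert ha, add_comm]
      convert (ih.sumElim (h a)).reindex (fun q : Σ a, κ a =>
        if e : q.1 = a then Sum.inr (e ▸ q.2) else Sum.inl q) using 3 with x q
      obtain ⟨b, k⟩ := q
      by_cases e : b = a
      · subst e; simp
      · simp [e]
  simpa using key Finset.univ

theorem family {A : Type*} [Fintype A] {F : A → (ι → K) → κ → K} {T : A → ℝ}
    (h : ∀ a, ComputableWithin (F a) (T a)) :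
    ComputableWithin (fun x (q : A × κ) => F q.1 x q.2) (∑ a, T a) :=
  (sigma h).reindex fun q : A × κ => ⟨q.1, q.2⟩

/-- One operation for each coordinate of two vectors. -/
theorem zipWith [Fintype κ] {F F' : (ι → K) → κ → K} {T T' : ℝ} (op : ArithOp)
    (h : ComputableWithin F T) (h' : ComputableWithin F' T') :
    ComputableWithin (fun x k => op.eval (F x k) (F' x k)) (T + T' + Fintype.card κ) := by
  have gate : ∀ k : κ, ComputableWithin
      (fun (y : κ ⊕ κ → K) (_ : Unit) => op.eval (y (.inl k)) (y (.inr k))) 1 := fun k =>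
    ⟨1, by simp, .snoc .nil op (.input (.inl k)) (.input (.inr k)), fun _ => .gate 0,
      fun x _ => rfl⟩
  have := (h.sumElim h').comp ((family gate).reindex fun k : κ => (k, ()))
  simpa using this

theorem add [Fintype κ] {F F' : (ι → K) → κ → K} {T T' : ℝ}
    (h : ComputableWithin F T) (h' : ComputableWithin F' T') :
    ComputableWithin (fun x k => F x k + F' x k) (T + T' + Fintype.card κ) :=
  h.zipWith .add h'

theorem const_mul [Fintype κ] {F : (ι → K) → κ → K} {T : ℝ} (h : ComputableWithin F T)
    (c : κ → K) : ComputableWithin (fun x k => c k * F x k) (T + Fintype.card κ) := by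
  exact ((const (ι := ι) c).zipWith .mul h).mono (by simp)

theorem sum [Fintype κ] {A : Type*} (s : Finset A) {F : A → (ι → K) → κ → K} {T : A → ℝ}
    (h : ∀ a ∈ s, ComputableWithin (F a) (T a)) :
    ComputableWithin (fun x k => ∑ a ∈ s, F a x k) (∑ a ∈ s, (T a + Fintype.card κ)) := by
  classical
  induction s using Finset.induction_on with
  | empty => simpa using const (ι := ι) (fun _ : κ => (0 : K))
  | insert a s ha ih =>
    simp only [Finset.sum_insert ha]
    refine ((h a (by simp)).add (ih fun b hb => h b (by simp [hb]))).mono (le_of_eq ?_)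
    ring

end ComputableWithin

end Circuits

/-! ### Matrix products with a constant factor -/

namespace ComputableWithin

/-- Padding an array with zeros is free. -/
theorem extend {K ι κ : Type*} [Field K] (f : ι → κ) :
    ComputableWithin (fun x : ι → K => Function.extend f x 0) 0 := by
  classical
  refine of_operand (fun k => if h : ∃ i, f i = k then .input h.choose else .const 0) fun x k => ?_
  by_cases h : ∃ i, f i = k <;> simp [h, Function.extend_def, Operand.eval]

end ComputableWithin

section MatMul

variable {b w : ℝ}

theorem matMul_const_nonneg
    (hM : ∀ n : ℕ, 1 ≤ n → ComputableWithin (matMulMap n) (b * (n : ℝ) ^ w)) : 0 ≤ b := by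
  simpa using (hM 1 le_rfl).nonneg

theorem computableWithin_square_mul_const
    (hM : ∀ n : ℕ, 1 ≤ n → ComputableWithin (matMulMap n) (b * (n : ℝ) ^ w))
    {n : ℕ} (hn : 1 ≤ n) (W : Fin n → Fin n → ℂ) :
    ComputableWithin (fun (x : Fin n × Fin n → ℂ) (p : Fin n × Fin n) =>
      ∑ k, x (p.1, k) * W k p.2) (b * (n : ℝ) ^ w) := by
  have h := ((ComputableWithin.proj (K := ℂ) (id : Fin n × Fin n → Fin n × Fin n)).sumElim
    (ComputableWithin.const fun p : Fin n × Fin n => W p.1 p.2)).comp (hM n hn)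
  refine h.congr (fun x p => ?_) (by simp)
  simp [matMulMap, Matrix.mul_apply]

/-- A product of matrices whose index sets embed into `a`, `a'`, `a''` blocks of size `m` takes
`a * a' * a''` products of `m × m` matrices. -/
theorem computableWithin_mul_const_of_embedding
    (hM : ∀ n : ℕ, 1 ≤ n → ComputableWithin (matMulMap n) (b * (n : ℝ) ^ w)) (hw : 2 ≤ w)
    {D E N : Type*} [Fintype E] {a a' a'' m : ℕ} (hm : 1 ≤ m)
    (iD : D ↪ Fin a × Fin m) (iE : E ↪ Fin a' × Fin m) (iN : N ↪ Fin a'' × Fin m)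
    (W : E → N → ℂ) :
    ComputableWithin (fun (x : D × E → ℂ) (q : D × N) => ∑ s, x (q.1, s) * W s q.2)
      (a * a' * a'' * ((b + 1) * (m : ℝ) ^ w)) := by
  set W' : (Fin a' × Fin m) × (Fin a'' × Fin m) → ℂ :=
    Function.extend (Prod.map iE iN) (fun p => W p.1 p.2) 0 with hW'
  have block : ∀ (u : Fin a × Fin a'') (β : Fin a'),
      ComputableWithin (fun (y : (Fin a × Fin m) × (Fin a' × Fin m) → ℂ) (p : Fin m × Fin m) =>
        ∑ k, y ((u.1, p.1), (β, k)) * W' ((β, k), (u.2, p.2))) (b * (m : ℝ) ^ w) := by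
    intro u β
    have := (ComputableWithin.proj (K := ℂ) (fun p : Fin m × Fin m =>
      (((u.1, p.1), (β, p.2)) : (Fin a × Fin m) × (Fin a' × Fin m)))).comp
      (computableWithin_square_mul_const hM hm fun k l => W' ((β, k), (u.2, l)))
    simpa using this
  have all := ComputableWithin.family fun u : Fin a × Fin a'' =>
    ComputableWithin.sum Finset.univ fun β _ => block u β
  have h := ((ComputableWithin.extend (K := ℂ) (Prod.map iD iE)).comp all).reindex
    fun q : D × N => (((iD q.1).1, (iN q.2).1), ((iD q.1).2, (iN q.2).2))
  have hm2 : (m : ℝ) * m ≤ (m : ℝ) ^ w := by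
    have h1 : (1 : ℝ) ≤ m := by exact_mod_cast hm
    calc (m : ℝ) * m = (m : ℝ) ^ (2 : ℝ) := by rw [Real.rpow_two, sq]
      _ ≤ _ := Real.rpow_le_rpow_of_exponent_le h1 hw
  refine h.congr (fun x q => ?_) ?_
  · have hinj : Function.Injective (Prod.map iD iE) := iD.injective.prodMap iE.injective
    have hinj' : Function.Injective (Prod.map iE iN) := iE.injective.prodMap iN.injective
    symm
    rw [← Fintype.sum_prod_type' (f := fun β k =>
      Function.extend (Prod.map iD iE) x 0 (((iD q.1).1, (iD q.1).2), (β, k)) *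
        W' ((β, k), ((iN q.2).1, (iN q.2).2)))]
    refine Fintype.sum_of_injective iE iE.injective _ _ (fun v hv => ?_) fun s => ?_
    · rw [Function.extend_apply', Pi.zero_apply, zero_mul]
      rintro ⟨⟨d, s⟩, e⟩
      exact hv ⟨s, congrArg Prod.snd e⟩
    · have e1 := hinj.extend_apply x 0 (q.1, s)
      have e2 := hinj'.extend_apply (fun p => W p.1 p.2) 0 (s, q.2)
      simp only [Prod.map_apply] at e1 e2
      simp only [hW', Prod.mk.eta, e1, e2]
  · simp only [Finset.sum_const, Finset.card_univ, Fintype.card_prod, Fintype.card_fin,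
      nsmul_eq_mul, Nat.cast_mul, zero_add]
    have : (a : ℝ) * a'' * (a' * (b * (m : ℝ) ^ w + m * m)) ≤
        a * a'' * (a' * (b * (m : ℝ) ^ w + (m : ℝ) ^ w)) := by gcongr
    refine this.trans (le_of_eq ?_)
    ring

theorem nonempty_embedding_blocks {X : Type*} [Fintype X] {m : ℕ} (hm : 0 < m) :
    Nonempty (X ↪ Fin (Fintype.card X / m + 1) × Fin m) := by
  refine Function.Embedding.nonempty_of_card_le ?_
  rw [Fintype.card_prod, Fintype.card_fin, Fintype.card_fin, mul_comm]
  exact (Nat.lt_mul_div_succ _ hm).le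

/-- Multiplication of a `D × E` matrix by a constant `E × N` matrix, when `E` is not larger than
`D`: the factors are cut into square blocks the size of the smaller of `E` and `N`. -/
theorem computableWithin_mul_const
    (hM : ∀ n : ℕ, 1 ≤ n → ComputableWithin (matMulMap n) (b * (n : ℝ) ^ w)) (hw : 2 ≤ w)
    {D E N : Type*} [Fintype D] [Fintype E] [Fintype N] (hED : Fintype.card E ≤ Fintype.card D)
    (W : E → N → ℂ) :
    ComputableWithin (fun (x : D × E → ℂ) (q : D × N) => ∑ s, x (q.1, s) * W s q.2)
      (8 * (b + 1) * (((Fintype.card D : ℝ) * Fintype.card E + Fintype.card D * Fintype.card N) *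
        (Fintype.card E : ℝ) ^ (w - 2))) := by
  have hb := matMul_const_nonneg hM
  rcases isEmpty_or_nonempty E with hE | hE
  · simpa using (ComputableWithin.const (ι := D × E) (fun _ : D × N => (0 : ℂ))).mono
      (by positivity)
  rcases isEmpty_or_nonempty N with hN | hN
  · exact (ComputableWithin.of_operand isEmptyElim fun _ k => isEmptyElim k).mono (by positivity)
  have hE0 : 0 < Fintype.card E := Fintype.card_pos
  have hN0 : 0 < Fintype.card N := Fintype.card_pos
  set d := Fintype.card D
  set e := Fintype.card E
  set n := Fintype.card N
  obtain ⟨m, hm⟩ : ∃ m, m = min e n := ⟨_, rfl⟩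
  have hm0 : 0 < m := by omega
  have hme : m ≤ e := by omega
  have hmn : m ≤ n := by omega
  have count : ∀ k : ℕ, m ≤ k → (((k / m + 1 : ℕ) : ℝ)) ≤ 2 * (k / m) := by
    intro k hk
    have h0 : (0 : ℝ) < m := by exact_mod_cast hm0
    have h1 : ((k / m : ℕ) : ℝ) ≤ (k : ℝ) / m := Nat.cast_div_le
    have h2 : (1 : ℝ) ≤ (k : ℝ) / m := by
      rw [le_div_iff₀ h0, one_mul]
      exact_mod_cast hk
    push_cast
    linarith
  obtain ⟨iD⟩ : Nonempty (D ↪ Fin (d / m + 1) × Fin m) := nonempty_embedding_blocks hm0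
  obtain ⟨iE⟩ : Nonempty (E ↪ Fin (e / m + 1) × Fin m) := nonempty_embedding_blocks hm0
  obtain ⟨iN⟩ : Nonempty (N ↪ Fin (n / m + 1) × Fin m) := nonempty_embedding_blocks hm0
  refine (computableWithin_mul_const_of_embedding hM hw hm0 iD iE iN W).mono ?_
  have hmR : (0 : ℝ) < m := by exact_mod_cast hm0
  have hpow : (m : ℝ) ^ w = m ^ 2 * (m : ℝ) ^ (w - 2) := by
    rw [← Real.rpow_natCast, ← Real.rpow_add hmR]
    congr 1
    push_cast
    ring
  have hmono : (m : ℝ) ^ (w - 2) ≤ (e : ℝ) ^ (w - 2) :=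
    Real.rpow_le_rpow hmR.le (by exact_mod_cast hme) (by linarith)
  have key : (d : ℝ) * e * n / m ≤ d * e + d * n := by
    rcases le_total e n with h | h
    · have : (m : ℝ) = e := by exact_mod_cast (hm.trans (min_eq_left h))
      rw [this, mul_right_comm, mul_div_assoc, div_self (by positivity), mul_one]
      exact le_add_of_nonneg_left (by positivity)
    · have : (m : ℝ) = n := by exact_mod_cast (hm.trans (min_eq_right h))
      rw [this, mul_div_assoc, div_self (by positivity), mul_one]
      exact le_add_of_nonneg_right (by positivity)
  calc ((d / m + 1 : ℕ) : ℝ) * ((e / m + 1 : ℕ) : ℝ) * ((n / m + 1 : ℕ) : ℝ) *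
        ((b + 1) * (m : ℝ) ^ w)
      ≤ (2 * (d / m)) * (2 * (e / m)) * (2 * (n / m)) * ((b + 1) * (m : ℝ) ^ w) := by
        gcongr
        · exact count d (hme.trans hED)
        · exact count e hme
        · exact count n hmn
    _ = 8 * (b + 1) * ((d * e * n / m) * (m : ℝ) ^ (w - 2)) := by
        rw [hpow]
        field_simp
        ring
    _ ≤ _ := by gcongr

/-- Block-wise multiplication by constant vectors. For each block `β`, a `D β × E β` matrix is
given; every column `n` is the product of the matrix of the block `f n` with a constant vector. The
columns which belong to the same block are treated together, as one matrix product. -/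
theorem computableWithin_blockMul
    (hM : ∀ n : ℕ, 1 ≤ n → ComputableWithin (matMulMap n) (b * (n : ℝ) ^ w)) (hw : 2 ≤ w)
    {B : Type*} {N : Type*} [Fintype B] [Fintype N] (D E : B → Type*) [∀ β, Fintype (D β)]
    [∀ β, Fintype (E β)] (hED : ∀ β, Fintype.card (E β) ≤ Fintype.card (D β)) {s : ℝ}
    (hs : ∀ β, (Fintype.card (E β) : ℝ) ≤ s) (f : N → B) (W : ∀ n, E (f n) → ℂ) :
    ComputableWithin (fun (x : (Σ β, D β × E β) → ℂ) (q : Σ n, D (f n)) =>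
        ∑ k, x ⟨f q.1, (q.2, k)⟩ * W q.1 k)
      (8 * (b + 1) * ((∑ β, (Fintype.card (D β) : ℝ) * Fintype.card (E β) +
        ∑ n, (Fintype.card (D (f n)) : ℝ)) * s ^ (w - 2))) := by
  classical
  have hb := matMul_const_nonneg hM
  have block : ∀ β : B, ComputableWithin (fun (x : (Σ β, D β × E β) → ℂ)
      (q : D β × {n // f n = β}) => ∑ k, x ⟨β, (q.1, k)⟩ * W q.2.1 (q.2.2.symm ▸ k))
      (0 + 8 * (b + 1) * (((Fintype.card (D β) : ℝ) * Fintype.card (E β) +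
        Fintype.card (D β) * Fintype.card {n // f n = β}) *
        (Fintype.card (E β) : ℝ) ^ (w - 2))) := fun β =>
    (ComputableWithin.proj (fun p : D β × E β => (⟨β, p⟩ : Σ β, D β × E β))).comp
      (computableWithin_mul_const hM hw (hED β)
        fun (k : E β) (n : {n // f n = β}) => W n.1 (n.2.symm ▸ k))
  refine ((ComputableWithin.sigma block).reindex
    fun q : Σ n, D (f n) => ⟨f q.1, (q.2, ⟨q.1, rfl⟩)⟩).mono ?_
  have hfib : ∑ n, (Fintype.card (D (f n)) : ℝ) =
      ∑ β, (Fintype.card (D β) : ℝ) * Fintype.card {n // f n = β} := by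
    rw [← Finset.sum_fiberwise Finset.univ f]
    refine Finset.sum_congr rfl fun β _ => ?_
    rw [Finset.sum_congr rfl fun n hn => by rw [(Finset.mem_filter.1 hn).2], Finset.sum_const,
      Fintype.card_subtype, nsmul_eq_mul, mul_comm]
  rw [hfib, ← Finset.sum_add_distrib, Finset.sum_mul, Finset.mul_sum]
  refine Finset.sum_le_sum fun β _ => ?_
  rw [zero_add]
  have := Real.rpow_le_rpow (Nat.cast_nonneg _) (hs β) (by linarith : 0 ≤ w - 2)
  gcongr

/-- Multiplication of the blocks of a block matrix by constant square matrices on both sides. -/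
theorem computableWithin_blockConj
    (hM : ∀ n : ℕ, 1 ≤ n → ComputableWithin (matMulMap n) (b * (n : ℝ) ^ w)) (hw : 2 ≤ w)
    {A : Type*} [Fintype A] (d : A → ℕ) {s : ℝ} (hs : ∀ a, (d a : ℝ) ≤ s)
    {I J K L : A → Type*} [∀ a, Fintype (I a)] [∀ a, Fintype (J a)] [∀ a, Fintype (K a)]
    [∀ a, Fintype (L a)] (hI : ∀ a, Fintype.card (I a) = d a) (hJ : ∀ a, Fintype.card (J a) = d a)
    (hK : ∀ a, Fintype.card (K a) = d a) (hL : ∀ a, Fintype.card (L a) = d a)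
    (P : ∀ a, Matrix (K a) (I a) ℂ) (Q : ∀ a, Matrix (J a) (L a) ℂ) :
    ComputableWithin (fun (x : (Σ a, I a × J a) → ℂ) (q : Σ a, K a × L a) =>
        (P q.1 * (Matrix.of fun i j => x ⟨q.1, (i, j)⟩) * Q q.1 : Matrix _ _ ℂ) q.2.1 q.2.2)
      (32 * (b + 1) * ((∑ a, (d a : ℝ) ^ 2) * s ^ (w - 2))) := by
  have hb := matMul_const_nonneg hM
  have block : ∀ a : A, ComputableWithin (fun (x : (Σ a, I a × J a) → ℂ) (q : K a × L a) =>
      (P a * (Matrix.of fun i j => x ⟨a, (i, j)⟩) * Q a : Matrix _ _ ℂ) q.1 q.2)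
      (32 * (b + 1) * ((d a : ℝ) ^ 2 * (d a : ℝ) ^ (w - 2))) := by
    intro a
    have left := (ComputableWithin.proj (K := ℂ)
      (fun p : J a × I a => (⟨a, (p.2, p.1)⟩ : Σ a, I a × J a))).comp
      (computableWithin_mul_const hM hw (by rw [hI, hJ]) fun i k => P a k i)
    have right := (left.reindex fun p : K a × J a => (p.2, p.1)).comp
      (computableWithin_mul_const hM hw (by rw [hJ, hK]) fun j l => Q a j l)
    refine right.congr (fun x q => ?_) (le_of_eq ?_)
    · simp only [Matrix.mul_apply, Matrix.of_apply]
      refine Finset.sum_congr rfl fun j _ => ?_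
      simp [mul_comm]
    · rw [hI, hJ, hK, hL]
      ring
  refine (ComputableWithin.sigma block).mono ?_
  rw [Finset.sum_mul, Finset.mul_sum]
  refine Finset.sum_le_sum fun a _ => ?_
  have := Real.rpow_le_rpow (Nat.cast_nonneg _) (hs a) (by linarith : 0 ≤ w - 2)
  gcongr

end MatMul

/-! ### Fourier transforms of arbitrary length -/

section Fourier

/-- The radix-2 step of the fast Fourier transform. -/
theorem computableWithin_fft_step {M : ℕ} {T : ℝ}
    (h : ∀ ζ : ℂ, ζ ^ M = 1 → ComputableWithin (fun (a : Fin M → ℂ) (i : Fin M) =>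
      ∑ j, a j * ζ ^ ((i : ℕ) * j)) T) (ζ : ℂ) (hζ : ζ ^ (M * 2) = 1) :
    ComputableWithin (fun (a : Fin (M * 2) → ℂ) (i : Fin (M * 2)) =>
      ∑ j, a j * ζ ^ ((i : ℕ) * j)) (2 * T + 4 * M) := by
  rcases Nat.eq_zero_or_pos M with rfl | hM
  · refine (ComputableWithin.of_operand (fun i : Fin (0 * 2) => i.elim0)
      fun _ i => i.elim0).mono ?_
    have := (h 0 (by simp)).nonneg
    simp [this]
  have h2 : (ζ ^ 2) ^ M = 1 := by rw [← pow_mul, mul_comm, hζ]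
  have half : ∀ r : Fin 2, ComputableWithin (fun (a : Fin (M * 2) → ℂ) (i : Fin (M * 2)) =>
      ∑ j : Fin M, a (finProdFinEquiv (j, r)) * (ζ ^ 2) ^ ((i : ℕ) % M * j)) (0 + T) := fun r =>
    ((ComputableWithin.proj (K := ℂ) fun j : Fin M => finProdFinEquiv (j, r)).comp
      (h (ζ ^ 2) h2)).reindex fun i : Fin (M * 2) => ⟨(i : ℕ) % M, Nat.mod_lt _ hM⟩
  refine ((half 0).add ((half 1).const_mul fun i => ζ ^ (i : ℕ))).congr (fun a i => ?_) ?_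
  · rw [← finProdFinEquiv.sum_comp, Fintype.sum_prod_type, Finset.mul_sum,
      ← Finset.sum_add_distrib]
    refine Finset.sum_congr rfl fun j _ => ?_
    have hmod : (ζ ^ 2) ^ ((i : ℕ) % M * j) = ζ ^ ((i : ℕ) * (2 * j)) := by
      rw [pow_mul, ← pow_eq_pow_mod _ h2, ← pow_mul, ← pow_mul]
      congr 1
      ring
    rw [Fin.sum_univ_two, hmod]
    simp only [finProdFinEquiv_apply_val, Fin.val_zero, Fin.val_one, zero_add, mul_add, mul_one,
      pow_add]
    ring
  · rw [Fintype.card_fin]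
    push_cast
    linarith

/-- The fast Fourier transform: length `2 ^ k` takes `2 * k * 2 ^ k` operations. -/
theorem computableWithin_fft (k : ℕ) : ∀ ζ : ℂ, ζ ^ 2 ^ k = 1 →
    ComputableWithin (fun (a : Fin (2 ^ k) → ℂ) (i : Fin (2 ^ k)) =>
      ∑ j, a j * ζ ^ ((i : ℕ) * j)) (2 * k * 2 ^ k) := by
  induction k with
  | zero =>
    intro ζ _
    refine (ComputableWithin.proj (K := ℂ) (id : Fin (2 ^ 0) → _)).congr (fun a i => ?_) (by simp)
    have : ∀ j : Fin (2 ^ 0), j = 0 := fun j => Fin.ext (by have := j.2; simp at this ⊢)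
    rw [Fintype.sum_eq_single 0 fun j hj => absurd (this j) hj, this i]
    simp
  | succ k ih =>
    intro ζ hζ
    rw [pow_succ] at hζ ⊢
    refine (computableWithin_fft_step ih ζ hζ).mono (le_of_eq ?_)
    push_cast
    ring

theorem choose_two_add (i j : ℕ) : (i + j).choose 2 = i.choose 2 + j.choose 2 + i * j := by
  rw [Nat.add_choose_eq]
  simp [Finset.Nat.antidiagonal_succ]
  ring

/-- Sequences of length `M` are combinations of the powers of a primitive `M`-th root of unity. -/
theorem exists_fourier_coeff {M : ℕ} {ξ : ℂ} (hξ : IsPrimitiveRoot ξ M) (u : ℕ → ℂ) :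
    ∃ c : Fin M → ℂ, ∀ m < M, ∑ t, c t * ξ ^ (m * (t : ℕ)) = u m := by
  set V := Matrix.vandermonde fun m : Fin M => ξ ^ (m : ℕ)
  have hV : IsUnit V.det := by
    rw [isUnit_iff_ne_zero, Matrix.det_vandermonde_ne_zero_iff]
    exact fun i j hij => Fin.ext (hξ.pow_inj i.2 j.2 hij)
  refine ⟨V⁻¹.mulVec fun m => u m, fun m hm => ?_⟩
  have := congrFun (Matrix.mulVec_mulVec (fun m : Fin M => u m) V V⁻¹) ⟨m, hm⟩
  rw [Matrix.mul_nonsing_inv _ hV, Matrix.one_mulVec] at this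
  rw [← this, Matrix.mulVec, dotProduct]
  refine Finset.sum_congr rfl fun t _ => ?_
  simp only [V, Matrix.vandermonde_apply, ← pow_mul, mul_comm]

/-- Bluestein's algorithm: since `i * j = (i + j).choose 2 - i.choose 2 - j.choose 2`, the
evaluation of a polynomial at a geometric progression is a correlation with a constant sequence, and
that is done by two Fourier transforms of a longer length. -/
theorem computableWithin_bluestein {n M : ℕ} (hM : 2 * n ≤ M) (hM0 : M ≠ 0) {T : ℝ}
    (h : ∀ ζ : ℂ, ζ ^ M = 1 → ComputableWithin (fun (a : Fin M → ℂ) (i : Fin M) =>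
      ∑ j, a j * ζ ^ ((i : ℕ) * j)) T) (μ : ℂ) {ζ : ℂ} (hζ : ζ ≠ 0) :
    ComputableWithin (fun (a : Fin n → ℂ) (i : Fin n) => ∑ j, a j * (μ * ζ ^ (i : ℕ)) ^ (j : ℕ))
      (2 * T + M + 2 * n) := by
  have hξ := Complex.isPrimitiveRoot_exp M hM0
  set ξ := Complex.exp (2 * Real.pi * Complex.I / M)
  obtain ⟨c, hc⟩ := exists_fourier_coeff hξ fun m => ζ ^ m.choose 2
  have hn : n ≤ M := by omega
  have scale := (ComputableWithin.proj (K := ℂ) (id : Fin n → Fin n)).const_mul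
    fun j => μ ^ (j : ℕ) * (ζ ^ (j : ℕ).choose 2)⁻¹
  have first := ((scale.comp (ComputableWithin.extend (Fin.castLE hn))).comp
    (h ξ hξ.pow_eq_one)).const_mul c
  have second := ((first.comp (h ξ hξ.pow_eq_one)).reindex (Fin.castLE hn)).const_mul
    fun i => (ζ ^ (i : ℕ).choose 2)⁻¹
  refine second.congr (fun a i => ?_) (le_of_eq ?_)
  · have inner : ∀ t : Fin M, ∑ j : Fin M, Function.extend (Fin.castLE hn)
        (fun j => μ ^ (j : ℕ) * (ζ ^ (j : ℕ).choose 2)⁻¹ * a (id j)) 0 j * ξ ^ ((t : ℕ) * j) =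
        ∑ j : Fin n, μ ^ (j : ℕ) * (ζ ^ (j : ℕ).choose 2)⁻¹ * a j * ξ ^ ((t : ℕ) * j) := by
      intro t
      symm
      refine Fintype.sum_of_injective _ (Fin.castLE_injective hn) _ _ (fun v hv => ?_) fun s => ?_
      · rw [Function.extend_apply' _ _ _ hv, Pi.zero_apply, zero_mul]
      · rw [(Fin.castLE_injective hn).extend_apply]
        simp
    simp only [inner, Finset.mul_sum, Finset.sum_mul]
    rw [Finset.sum_comm]
    refine Finset.sum_congr rfl fun j _ => ?_
    have hij : (i : ℕ) + j < M := by omega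
    have key := hc _ hij
    rw [choose_two_add, pow_add, pow_add] at key
    have hi : ζ ^ (i : ℕ).choose 2 ≠ 0 := pow_ne_zero _ hζ
    have hj : ζ ^ (j : ℕ).choose 2 ≠ 0 := pow_ne_zero _ hζ
    have expand : ∀ t : Fin M, (ζ ^ (i : ℕ).choose 2)⁻¹ *
        (c t * (μ ^ (j : ℕ) * (ζ ^ (j : ℕ).choose 2)⁻¹ * a j * ξ ^ ((t : ℕ) * j)) *
          ξ ^ ((Fin.castLE hn i : ℕ) * t)) =
        (ζ ^ (i : ℕ).choose 2)⁻¹ * μ ^ (j : ℕ) * (ζ ^ (j : ℕ).choose 2)⁻¹ * a j *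
          (c t * ξ ^ (((i : ℕ) + j) * t)) := by
      intro t
      rw [Fin.val_castLE, add_mul, pow_add, mul_comm (j : ℕ) (t : ℕ)]
      ring
    rw [Finset.sum_congr rfl fun t _ => expand t, ← Finset.mul_sum, key, mul_pow, ← pow_mul]
    field_simp
  · simp only [Fintype.card_fin]
    ring

/-- The Fourier transform of any length `n`, twisted by `μ`, takes `O(n ^ α)` operations for every
`α > 1`. -/
theorem exists_computableWithin_fourier {α : ℝ} (hα : 1 < α) :
    ∃ c : ℝ, 0 ≤ c ∧ ∀ (n : ℕ) (μ ζ : ℂ), ζ ≠ 0 →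
      ComputableWithin (fun (a : Fin n → ℂ) (i : Fin n) =>
        ∑ j, a j * (μ * ζ ^ (i : ℕ)) ^ (j : ℕ)) (c * (n : ℝ) ^ α) := by
  set δ := α - 1 with hδ
  have hδ0 : 0 < δ := by linarith
  have hlog : 0 < Real.log 2 := Real.log_pos one_lt_two
  set e := (δ * Real.log 2)⁻¹ with he
  have he0 : 0 < e := by positivity
  refine ⟨(4 * e + 2) * 4 ^ α, by positivity, fun n μ ζ hζ => ?_⟩
  rcases Nat.eq_zero_or_pos n with rfl | hn
  · exact (ComputableWithin.of_operand (fun i => i.elim0) fun _ i => i.elim0).mono (by positivity)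
  obtain ⟨k, hk1, hk2⟩ : ∃ k : ℕ, 2 * n ≤ 2 ^ k ∧ 2 ^ k ≤ 4 * n := by
    refine ⟨Nat.log 2 n + 2, ?_, ?_⟩
    · have := Nat.lt_pow_succ_log_self one_lt_two n
      rw [pow_succ]
      omega
    · have := Nat.pow_log_le_self 2 hn.ne'
      rw [pow_add]
      omega
  refine (computableWithin_bluestein hk1 (by positivity) (computableWithin_fft k) μ hζ).mono ?_
  have hx1 : (1 : ℝ) ≤ 2 ^ k := one_le_pow₀ one_le_two
  have hk1' : 2 * (n : ℝ) ≤ 2 ^ k := by exact_mod_cast hk1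
  have hk2' : (2 : ℝ) ^ k ≤ 4 * n := by exact_mod_cast hk2
  -- The logarithmic factor `k` is absorbed by the power `δ = α - 1` of the length `2 ^ k`.
  have hkδ : (k : ℝ) ≤ e * ((2 : ℝ) ^ k) ^ δ := by
    have h1 := Real.add_one_le_exp (k * (δ * Real.log 2))
    have h2 : ((2 : ℝ) ^ k) ^ δ = Real.exp (k * (δ * Real.log 2)) := by
      rw [Real.rpow_def_of_pos (by positivity), Real.log_pow]
      congr 1
      ring
    rw [h2, he, inv_mul_eq_div, le_div_iff₀ (by positivity)]
    linarith
  have hpow : ((2 : ℝ) ^ k) ^ α = ((2 : ℝ) ^ k) ^ δ * 2 ^ k := by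
    rw [show α = δ + 1 by rw [hδ]; ring, Real.rpow_add (by positivity), Real.rpow_one]
  have hle : (2 : ℝ) ^ k ≤ ((2 : ℝ) ^ k) ^ α := Real.self_le_rpow_of_one_le hx1 hα.le
  calc 2 * (2 * (k : ℝ) * 2 ^ k) + ((2 ^ k : ℕ) : ℝ) + 2 * n
      ≤ 2 * (2 * (e * ((2 : ℝ) ^ k) ^ δ) * 2 ^ k) + 2 ^ k + 2 ^ k := by
        push_cast
        gcongr
    _ = 4 * e * ((2 : ℝ) ^ k) ^ α + 2 * 2 ^ k := by rw [hpow]; ring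
    _ ≤ 4 * e * ((2 : ℝ) ^ k) ^ α + 2 * ((2 : ℝ) ^ k) ^ α := by gcongr
    _ = (4 * e + 2) * ((2 : ℝ) ^ k) ^ α := by ring
    _ ≤ (4 * e + 2) * (4 * (n : ℝ)) ^ α := by gcongr
    _ = _ := by rw [Real.mul_rpow (by norm_num) (by positivity)]; ring

end Fourier

/-! ### Irreducible matrix representations -/

section Representations

variable {G : Type*} [Group G]

theorem matrixRep_apply {d : ℕ} (ρ : G →* Matrix (Fin d) (Fin d) ℂ) (g : G) :
    matrixRep ρ g = Matrix.toLin' (ρ g) := rfl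

theorem Representation.Equiv.isIrreducible {V W : Type*} [AddCommGroup V] [Module ℂ V]
    [AddCommGroup W] [Module ℂ W] {ρ : Representation ℂ G V} {σ : Representation ℂ G W}
    (e : ρ.Equiv σ) (h : σ.IsIrreducible) : ρ.IsIrreducible := by
  rw [Representation.irreducible_iff_isSimpleModule_asModule] at h ⊢
  exact IsSimpleModule.congr (LinearEquiv.ofBijective
    (Representation.IntertwiningMap.equivLinearMapAsModule ρ σ e.toIntertwiningMap)
    e.toLinearEquiv.bijective)

theorem dim_pos_of_isIrreducible {d : ℕ} {ρ : G →* Matrix (Fin d) (Fin d) ℂ}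
    (h : (matrixRep ρ).IsIrreducible) : 0 < d := by
  rcases Nat.eq_zero_or_pos d with rfl | hd
  · exact absurd (Subrepresentation.toSubmodule_injective (Subsingleton.elim _ _))
      (bot_ne_top (α := Subrepresentation (matrixRep ρ)))
  · exact hd

/-- The intertwining map of a matrix that commutes with the action of the group. -/
def intertwiningOfMatrix {d e : ℕ} (ρ : G →* Matrix (Fin d) (Fin d) ℂ)
    (σ : G →* Matrix (Fin e) (Fin e) ℂ) (B : Matrix (Fin e) (Fin d) ℂ)
    (h : ∀ g, B * ρ g = σ g * B) :
    Representation.IntertwiningMap (matrixRep ρ) (matrixRep σ) where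
  toLinearMap := Matrix.toLin' B
  isIntertwining' g := by
    rw [matrixRep_apply, matrixRep_apply, ← Matrix.toLin'_mul, ← Matrix.toLin'_mul, h]

/-- Similar matrix representations are equivalent. -/
theorem nonempty_equiv_of_mul_eq {d e : ℕ} {ρ : G →* Matrix (Fin d) (Fin d) ℂ}
    {σ : G →* Matrix (Fin e) (Fin e) ℂ} {B : Matrix (Fin e) (Fin d) ℂ}
    {B' : Matrix (Fin d) (Fin e) ℂ} (h : ∀ g, B * ρ g = σ g * B) (hB : B * B' = 1)
    (hB' : B' * B = 1) : Nonempty ((matrixRep ρ).Equiv (matrixRep σ)) :=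
  ⟨Representation.Equiv.mk (Matrix.toLin'OfInv hB' hB) fun g =>
    (intertwiningOfMatrix ρ σ B h).isIntertwining' g⟩

variable [Fintype G]

theorem average_intertwines {d e : ℕ} (ρ : G →* Matrix (Fin d) (Fin d) ℂ)
    (σ : G →* Matrix (Fin e) (Fin e) ℂ) (A : Matrix (Fin d) (Fin e) ℂ) (h : G) :
    (∑ g, ρ g * A * σ g⁻¹) * σ h = ρ h * ∑ g, ρ g * A * σ g⁻¹ := by
  rw [Matrix.sum_mul, Matrix.mul_sum, ← Equiv.sum_comp (Equiv.mulLeft h)]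
  refine Finset.sum_congr rfl fun g _ => ?_
  rw [Equiv.coe_mulLeft, map_mul, Matrix.mul_assoc, ← map_mul σ]
  simp [Matrix.mul_assoc]

/-- Schur orthogonality for inequivalent representations. -/
theorem average_eq_zero {d e : ℕ} {ρ : G →* Matrix (Fin d) (Fin d) ℂ}
    {σ : G →* Matrix (Fin e) (Fin e) ℂ} (hρ : (matrixRep ρ).IsIrreducible)
    (hσ : (matrixRep σ).IsIrreducible) (hne : IsEmpty ((matrixRep σ).Equiv (matrixRep ρ)))
    (A : Matrix (Fin d) (Fin e) ℂ) : ∑ g, ρ g * A * σ g⁻¹ = 0 := by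
  have h0 : intertwiningOfMatrix σ ρ _ (average_intertwines ρ σ A) = 0 := Subsingleton.elim _ _
  exact Matrix.toLin'.map_eq_zero_iff.1
    (congrArg Representation.IntertwiningMap.toLinearMap h0)

/-- Schur orthogonality for one representation. -/
theorem average_eq_smul {d : ℕ} {ρ : G →* Matrix (Fin d) (Fin d) ℂ}
    (hρ : (matrixRep ρ).IsIrreducible) (A : Matrix (Fin d) (Fin d) ℂ) :
    ∑ g, ρ g * A * ρ g⁻¹ = ((Fintype.card G : ℂ) * A.trace / d) • (1 : Matrix _ _ ℂ) := by
  have hscalar :=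
    Representation.IsIrreducible.algebraMap_intertwiningMap_bijective_of_isAlgClosed
      (ρ := matrixRep ρ)
  obtain ⟨c, hc⟩ := hscalar.2 (intertwiningOfMatrix ρ ρ _ (average_intertwines ρ ρ A))
  have h1 : ∑ g, ρ g * A * ρ g⁻¹ = c • (1 : Matrix _ _ ℂ) := by
    apply Matrix.toLin'.injective
    rw [map_smul, Matrix.toLin'_one]
    exact (congrArg Representation.IntertwiningMap.toLinearMap hc).symm
  have hd : (d : ℂ) ≠ 0 := by exact_mod_cast (dim_pos_of_isIrreducible hρ).ne'
  have h2 := congrArg Matrix.trace h1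
  rw [Matrix.trace_sum, Matrix.trace_smul, Matrix.trace_one, Fintype.card_fin] at h2
  have h3 : ∀ g : G, (ρ g * A * ρ g⁻¹).trace = A.trace := fun g => by
    rw [Matrix.trace_mul_comm, ← Matrix.mul_assoc, ← map_mul]
    simp
  simp only [h3, Finset.sum_const, Finset.card_univ, nsmul_eq_mul, smul_eq_mul] at h2
  rw [h1, h2, mul_div_assoc, div_self hd, mul_one]

/-- The matrix coefficients of pairwise inequivalent irreducible representations are linearly
independent, hence there are at most `|G|` of them. -/
theorem sum_dim_sq_le_of_inequivalent {ι : Type*} [Fintype ι] (dim : ι → ℕ)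
    (rep : ∀ i, G →* Matrix (Fin (dim i)) (Fin (dim i)) ℂ)
    (irr : ∀ i, (matrixRep (rep i)).IsIrreducible)
    (ineq : ∀ i j, Nonempty ((matrixRep (rep i)).Equiv (matrixRep (rep j))) → i = j) :
    ∑ i, dim i ^ 2 ≤ Fintype.card G := by
  classical
  have hli : LinearIndependent ℂ
      fun (q : Σ i, Fin (dim i) × Fin (dim i)) (g : G) => rep q.1 g q.2.1 q.2.2 := by
    rw [Fintype.linearIndependent_iff]
    rintro a ha ⟨j, v, u⟩
    have coeff : ∀ (i : ι) (k l : Fin (dim i)), ∑ g, rep i g k l * rep j g⁻¹ u v =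
        (∑ g, rep i g * Matrix.single l u (1 : ℂ) * rep j g⁻¹) k v := by
      intro i k l
      rw [Matrix.sum_apply]
      refine Finset.sum_congr rfl fun g _ => ?_
      rw [Matrix.mul_apply, Fintype.sum_eq_single u]
      · simp
      · intro x hx
        rw [Matrix.mul_single_apply_of_ne _ _ _ _ _ hx, zero_mul]
    have h0 : ∑ q : Σ i, Fin (dim i) × Fin (dim i),
        a q * ∑ g, rep q.1 g q.2.1 q.2.2 * rep j g⁻¹ u v = 0 := by
      simp only [Finset.mul_sum, ← mul_assoc]
      rw [Finset.sum_comm]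
      refine Finset.sum_eq_zero fun g _ => ?_
      rw [← Finset.sum_mul]
      have := congrFun ha g
      simp only [Finset.sum_apply, Pi.smul_apply, smul_eq_mul, Pi.zero_apply] at this
      rw [this, zero_mul]
    have hd : (dim j : ℂ) ≠ 0 := by exact_mod_cast (dim_pos_of_isIrreducible (irr j)).ne'
    have hG : (Fintype.card G : ℂ) ≠ 0 := by exact_mod_cast Fintype.card_ne_zero
    rw [Fintype.sum_eq_single ⟨j, v, u⟩] at h0
    · rw [coeff, average_eq_smul (irr j)] at h0
      simpa [hd, hG] using h0
    · rintro ⟨i, k, l⟩ hne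
      rw [coeff]
      by_cases hij : i = j
      · subst hij
        rw [average_eq_smul (irr i)]
        by_cases hlu : l = u
        · subst hlu
          have : k ≠ v := fun h => hne (by rw [h])
          simp [Matrix.one_apply_ne this]
        · simp [Matrix.trace_single_eq_of_ne _ _ _ hlu]
      · rw [average_eq_zero (irr i) (irr j) ⟨fun e => hij (ineq j i ⟨e⟩).symm⟩]
        simp
  have := hli.fintype_card_le_finrank
  simpa [Fintype.card_sigma, sq] using this

theorem IrrSet.sum_dim_sq_le (R : IrrSet G) : ∑ i, R.dim i ^ 2 ≤ Fintype.card G :=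
  sum_dim_sq_le_of_inequivalent R.dim R.rep R.irreducible R.pairwise_inequivalent

theorem IrrSet.sum_dim_sq_le_real (R : IrrSet G) :
    ∑ i, (R.dim i : ℝ) ^ 2 ≤ Fintype.card G := by
  exact_mod_cast R.sum_dim_sq_le

theorem IrrSet.dim_le_sqrt (R : IrrSet G) (i : Fin R.num) :
    (R.dim i : ℝ) ≤ √(Fintype.card G) := by
  refine Real.le_sqrt_of_sq_le (le_trans ?_ R.sum_dim_sq_le_real)
  exact Finset.single_le_sum (f := fun i => (R.dim i : ℝ) ^ 2) (fun _ _ => by positivity)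
    (Finset.mem_univ i)

variable (G) in
/-- There are at most `|G|` pairwise inequivalent irreducible representations, so an incomplete
family can be enlarged only finitely often. -/
theorem nonempty_irrSet : Nonempty (IrrSet G) := by
  by_contra hno
  have key : ∀ n : ℕ, ∃ F : Fin n → Σ d, (G →* Matrix (Fin d) (Fin d) ℂ),
      (∀ i, (matrixRep (F i).2).IsIrreducible) ∧
      ∀ i j, Nonempty ((matrixRep (F i).2).Equiv (matrixRep (F j).2)) → i = j := by
    intro n
    induction n with
    | zero => exact ⟨Fin.elim0, fun i => i.elim0, fun i => i.elim0⟩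
    | succ n ih =>
      obtain ⟨F, hirr, hineq⟩ := ih
      by_cases hc : ∀ (d : ℕ) (σ : G →* Matrix (Fin d) (Fin d) ℂ),
          (matrixRep σ).IsIrreducible → ∃ i, Nonempty ((matrixRep σ).Equiv (matrixRep (F i).2))
      · exact absurd ⟨⟨n, fun i => (F i).1, fun i => (F i).2, hirr, hineq, hc⟩⟩ hno
      push Not at hc
      obtain ⟨d, σ, hσ, hne⟩ := hc
      refine ⟨Fin.cons ⟨d, σ⟩ F, Fin.cases hσ hirr, ?_⟩
      intro i j hij
      induction i using Fin.cases with
      | zero =>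
        induction j using Fin.cases with
        | zero => rfl
        | succ j => exact absurd hij (not_nonempty_iff.2 (hne j))
      | succ i =>
        induction j using Fin.cases with
        | zero =>
          obtain ⟨e⟩ := hij
          exact absurd ⟨e.symm⟩ (not_nonempty_iff.2 (hne i))
        | succ j => rw [hineq i j hij]
  obtain ⟨F, hirr, hineq⟩ := key (Fintype.card G + 1)
  have h1 := sum_dim_sq_le_of_inequivalent (fun i => (F i).1) (fun i => (F i).2) hirr hineq
  have h2 : ∑ _i : Fin (Fintype.card G + 1), 1 ≤ ∑ i, (F i).1 ^ 2 :=
    Finset.sum_le_sum fun i _ => Nat.one_le_pow _ _ (dim_pos_of_isIrreducible (hirr i))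
  simp at h2
  omega

end Representations

/-! ### Complete reducibility -/

section Decomposition

variable {G : Type*} [Group G]

/-- The representation `ρ` has a basis in which it is a direct sum of members of `R`. The summands
are indexed by a finite type `T`, and the summand `t` is the member `s t` of `R`. -/
def HasAdaptedBasis (R : IrrSet G) {V : Type} [AddCommGroup V] [Module ℂ V]
    (ρ : Representation ℂ G V) : Prop :=
  ∃ (T : Type) (_ : Fintype T) (s : T → Fin R.num)
    (b : Module.Basis (Σ t, Fin (R.dim (s t))) ℂ V),
    ∀ (g : G) (t : T) (j : Fin (R.dim (s t))),
      ρ g (b ⟨t, j⟩) = ∑ i, R.rep (s t) g i j • b ⟨t, i⟩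

theorem HasAdaptedBasis.of_isIrreducible (R : IrrSet G) {V : Type} [AddCommGroup V] [Module ℂ V]
    [FiniteDimensional ℂ V] {ρ : Representation ℂ G V} (hρ : ρ.IsIrreducible) :
    HasAdaptedBasis R ρ := by
  let c := Module.finBasis ℂ V
  let σ : G →* Matrix (Fin (Module.finrank ℂ V)) (Fin (Module.finrank ℂ V)) ℂ :=
    ((LinearMap.toMatrixAlgEquiv c : _ →* Matrix _ _ ℂ)).comp ρ
  have e : (matrixRep σ).Equiv ρ := Representation.Equiv.mk c.equivFun.symm fun g => by
    refine LinearMap.ext fun v => ?_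
    rw [matrixRep_apply]
    apply c.equivFun.injective
    have := LinearMap.toMatrix_mulVec_repr c c (ρ g) (c.equivFun.symm v)
    simp only [LinearMap.comp_apply, LinearEquiv.coe_coe, LinearEquiv.apply_symm_apply,
      Matrix.toLin'_apply]
    rw [Module.Basis.equivFun_apply, ← this, ← Module.Basis.equivFun_apply,
      LinearEquiv.apply_symm_apply]
    rfl
  obtain ⟨i, ⟨f⟩⟩ := R.complete _ σ (e.isIrreducible hρ)
  let E : (matrixRep (R.rep i)).Equiv ρ := f.symm.trans e
  refine ⟨Unit, inferInstance, fun _ => i, ((Pi.basisFun ℂ (Fin (R.dim i))).map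
    E.toLinearEquiv).reindex (Equiv.uniqueSigma fun _ : Unit => Fin (R.dim i)).symm, ?_⟩
  intro g t j
  have h1 := Representation.IntertwiningMap.isIntertwining _ _ E.toIntertwiningMap g
    (Pi.single j 1)
  have h2 : matrixRep (R.rep i) g (Pi.single j 1) =
      ∑ k, R.rep i g k j • Pi.single (M := fun _ => ℂ) k 1 := by
    rw [matrixRep_apply, Matrix.toLin'_apply, Matrix.mulVec_single_one]
    funext k
    simp [Finset.sum_apply, Pi.single_apply]
  rw [h2] at h1
  simp only [Module.Basis.reindex_apply, Equiv.symm_symm, Module.Basis.map_apply,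
    Pi.basisFun_apply]
  refine (h1.symm.trans ?_)
  simp only [map_sum, map_smul]
  rfl

theorem HasAdaptedBasis.of_isCompl (R : IrrSet G) {V : Type} [AddCommGroup V] [Module ℂ V]
    {ρ : Representation ℂ G V} {U U' : Subrepresentation ρ} (h : IsCompl U U')
    (hU : HasAdaptedBasis R U.toRepresentation) (hU' : HasAdaptedBasis R U'.toRepresentation) :
    HasAdaptedBasis R ρ := by
  obtain ⟨T, _, s, b, hb⟩ := hU
  obtain ⟨T', _, s', b', hb'⟩ := hU'
  have hc : IsCompl U.toSubmodule U'.toSubmodule := by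
    refine IsCompl.of_eq ?_ ?_
    · exact congrArg Subrepresentation.toSubmodule h.inf_eq_bot
    · exact congrArg Subrepresentation.toSubmodule h.sup_eq_top
  let B := ((b.prod b').map (Submodule.prodEquivOfIsCompl _ _ hc)).reindex
    (Equiv.sumSigmaDistrib fun t : T ⊕ T' => Fin (R.dim (Sum.elim s s' t))).symm
  have hB : ∀ (t : T) (j : Fin (R.dim (s t))), B ⟨.inl t, j⟩ = b ⟨t, j⟩ := fun t j => by
    refine (Module.Basis.reindex_apply _ _ _).trans ((Module.Basis.map_apply _ _ _).trans ?_)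
    refine (congrArg _ (Module.Basis.prod_apply b b' (.inl ⟨t, j⟩))).trans ?_
    simp
  have hB' : ∀ (t : T') (j : Fin (R.dim (s' t))), B ⟨.inr t, j⟩ = b' ⟨t, j⟩ := fun t j => by
    refine (Module.Basis.reindex_apply _ _ _).trans ((Module.Basis.map_apply _ _ _).trans ?_)
    refine (congrArg _ (Module.Basis.prod_apply b b' (.inr ⟨t, j⟩))).trans ?_
    simp
  refine ⟨T ⊕ T', inferInstance, Sum.elim s s', B, fun g t => ?_⟩
  cases t with
  | inl t =>
    intro j
    refine (congrArg (ρ g) (hB t j)).trans ((congrArg Subtype.val (hb g t j)).trans ?_)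
    simp only [Submodule.coe_sum, Submodule.coe_smul]
    exact Finset.sum_congr rfl fun i _ => congrArg _ (hB t i).symm
  | inr t =>
    intro j
    refine (congrArg (ρ g) (hB' t j)).trans ((congrArg Subtype.val (hb' g t j)).trans ?_)
    simp only [Submodule.coe_sum, Submodule.coe_smul]
    exact Finset.sum_congr rfl fun i _ => congrArg _ (hB' t i).symm

variable [Fintype G]

/-- By Maschke's theorem and induction on the dimension, every representation has an adapted
basis. -/
theorem hasAdaptedBasis (R : IrrSet G) (n : ℕ) : ∀ {V : Type} [AddCommGroup V] [Module ℂ V]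
    [FiniteDimensional ℂ V] (ρ : Representation ℂ G V), Module.finrank ℂ V = n →
    HasAdaptedBasis R ρ := by
  induction n using Nat.strong_induction_on with
  | _ n ih =>
  intro V _ _ _ ρ hn
  rcases subsingleton_or_nontrivial V with hV | hV
  · exact ⟨Empty, inferInstance, Empty.elim, Module.Basis.empty V, fun _ t => t.elim⟩
  have : Nontrivial (Subrepresentation ρ) :=
    ⟨⊥, ⊤, fun h => bot_ne_top (α := Submodule ℂ V) (congrArg Subrepresentation.toSubmodule h)⟩
  by_cases hirr : ∀ U : Subrepresentation ρ, U = ⊥ ∨ U = ⊤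
  · exact .of_isIrreducible R ⟨hirr⟩
  push Not at hirr
  obtain ⟨U, hbot, htop⟩ := hirr
  obtain ⟨U', hU'⟩ := exists_isCompl U
  have lt : ∀ W : Subrepresentation ρ, W ≠ ⊤ → Module.finrank ℂ W.toSubmodule < n := by
    intro W hW
    rw [← hn]
    exact Submodule.finrank_lt fun h => hW (Subrepresentation.toSubmodule_injective h)
  have htop' : U' ≠ ⊤ := fun h => hbot (by simpa [h] using hU'.inf_eq_bot)
  exact .of_isCompl R hU' (ih _ (lt U htop) _ rfl) (ih _ (lt U' htop') _ rfl)

/-- Complete reducibility in matrix form: every matrix representation is similar to a block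
diagonal one, with members of the given complete set as blocks. -/
theorem IrrSet.exists_blockDiagonal (R : IrrSet G) {d : ℕ}
    (σ : G →* Matrix (Fin d) (Fin d) ℂ) :
    ∃ (T : Type) (_ : Fintype T) (_ : DecidableEq T) (s : T → Fin R.num)
      (P : Matrix (Fin d) (Σ t, Fin (R.dim (s t))) ℂ)
      (Q : Matrix (Σ t, Fin (R.dim (s t))) (Fin d) ℂ), P * Q = 1 ∧ Q * P = 1 ∧
      Fintype.card (Σ t, Fin (R.dim (s t))) = d ∧
      ∀ g, σ g * P = P * Matrix.blockDiagonal' fun t => R.rep (s t) g := by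
  classical
  obtain ⟨T, _, s, b, hb⟩ := hasAdaptedBasis R _ (matrixRep σ) rfl
  let c := Pi.basisFun ℂ (Fin d)
  refine ⟨T, inferInstance, inferInstance, s, c.toMatrix b, b.toMatrix c,
    Module.Basis.toMatrix_mul_toMatrix_flip c b, Module.Basis.toMatrix_mul_toMatrix_flip b c,
    ?_, fun g => ?_⟩
  · rw [← Module.finrank_eq_card_basis b, Module.finrank_fin_fun]
  · ext k ⟨t, j⟩
    have h1 := congrFun (hb g t j) k
    rw [matrixRep_apply, Matrix.toLin'_apply] at h1
    have h2 : (σ g * c.toMatrix b) k ⟨t, j⟩ = (σ g).mulVec (b ⟨t, j⟩) k := by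
      simp [Matrix.mul_apply, Matrix.mulVec, dotProduct, Module.Basis.toMatrix_apply, c]
    rw [h2, h1, Matrix.mul_apply, Fintype.sum_sigma, Fintype.sum_eq_single t]
    · simp [Matrix.blockDiagonal'_apply_eq, Module.Basis.toMatrix_apply, c, mul_comm]
    · intro t' ht'
      exact Finset.sum_eq_zero fun i _ => by
        rw [Matrix.blockDiagonal'_apply_ne _ _ _ ht', mul_zero]

/-- A matrix of finite order is diagonalizable. -/
theorem exists_diagonalization {d n : ℕ} (hn : n ≠ 0) {A : Matrix (Fin d) (Fin d) ℂ}
    (hA : A ^ n = 1) : ∃ (P Q : Matrix (Fin d) (Fin d) ℂ) (l : Fin d → ℂ), P * Q = 1 ∧ Q * P = 1 ∧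
      (∀ m : ℕ, A ^ m * P = P * Matrix.diagonal fun j => l j ^ m) ∧ ∀ j, l j ^ n = 1 := by
  classical
  let f : Module.End ℂ (Fin d → ℂ) := Matrix.toLin' A
  have hf : f.IsSemisimple := by
    refine Module.End.isSemisimple_of_squarefree_aeval_eq_zero (p := Polynomial.X ^ n - 1)
      (Polynomial.Separable.squarefree ?_) ?_
    · exact (Polynomial.separable_X_pow_sub_C (1 : ℂ) (by exact_mod_cast hn) one_ne_zero)
    · have : f ^ n = 1 := by
        rw [← Matrix.toLin'_pow, hA, Matrix.toLin'_one]
        rfl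
      simp [this]
  let S : Set (Fin d → ℂ) := {v | ∃ μ : ℂ, f v = μ • v}
  have hS : ⊤ ≤ Submodule.span ℂ S := by
    rw [← hf.iSup_eigenspace_eq_top]
    refine iSup_le fun μ v hv => Submodule.subset_span ⟨μ, Module.End.mem_eigenspace_iff.1 hv⟩
  let b0 := Module.Basis.ofSpan hS
  have hb0 : ∀ i, b0 i ∈ S := fun i => Module.Basis.ofSpan_subset hS ⟨i, rfl⟩
  have : Fintype _ := FiniteDimensional.fintypeBasisIndex b0
  let b := b0.reindex (Fintype.equivFinOfCardEq (n := d) (by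
    rw [← Module.finrank_eq_card_basis b0, Module.finrank_fin_fun]))
  have hb : ∀ i, ∃ μ : ℂ, f (b i) = μ • b i := fun i => by
    rw [Module.Basis.reindex_apply]
    exact hb0 _
  choose l hl using hb
  let c := Pi.basisFun ℂ (Fin d)
  have hPQ := Module.Basis.toMatrix_mul_toMatrix_flip c b
  have hQP := Module.Basis.toMatrix_mul_toMatrix_flip b c
  have hAP : A * c.toMatrix b = c.toMatrix b * Matrix.diagonal l := by
    ext k j
    have h1 := congrFun (hl j) k
    rw [Matrix.mul_diagonal]
    simp only [f, Matrix.toLin'_apply, Matrix.mulVec, dotProduct, Pi.smul_apply,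
      smul_eq_mul] at h1
    simp only [Matrix.mul_apply, Module.Basis.toMatrix_apply, c, Pi.basisFun_repr]
    rw [h1, mul_comm]
  have hpow : ∀ m : ℕ, A ^ m * c.toMatrix b = c.toMatrix b * Matrix.diagonal fun j => l j ^ m := by
    intro m
    induction m with
    | zero => simp
    | succ m ih =>
      rw [pow_succ, Matrix.mul_assoc, hAP, ← Matrix.mul_assoc, ih, Matrix.mul_assoc,
        Matrix.diagonal_mul_diagonal]
      simp only [pow_succ]
  refine ⟨c.toMatrix b, b.toMatrix c, l, hPQ, hQP, hpow, fun j => ?_⟩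
  have h1 := hpow n
  rw [hA, Matrix.one_mul] at h1
  have h2 := congrArg (b.toMatrix c * ·) h1
  simp only [← Matrix.mul_assoc, hQP, Matrix.one_mul] at h2
  simpa using (congrFun (congrFun h2 j) j).symm

/-- The complete set obtained from `R` by a change of basis in every representation. -/
noncomputable def IrrSet.conj (R : IrrSet G) (P Q : ∀ i, Matrix (Fin (R.dim i)) (Fin (R.dim i)) ℂ)
    (hPQ : ∀ i, P i * Q i = 1) (hQP : ∀ i, Q i * P i = 1) : IrrSet G :=
  let rep : ∀ i, G →* Matrix (Fin (R.dim i)) (Fin (R.dim i)) ℂ := fun i =>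
    { toFun := fun g => Q i * R.rep i g * P i
      map_one' := by simp [hQP]
      map_mul' := fun g h => by
        rw [map_mul]
        calc Q i * (R.rep i g * R.rep i h) * P i
            = Q i * R.rep i g * 1 * R.rep i h * P i := by simp [Matrix.mul_assoc]
          _ = _ := by rw [← hPQ i]; simp [Matrix.mul_assoc] }
  have e : ∀ i, Nonempty ((matrixRep (rep i)).Equiv (matrixRep (R.rep i))) := fun i =>
    nonempty_equiv_of_mul_eq (B := P i) (B' := Q i) (fun g => by
      change P i * (Q i * R.rep i g * P i) = _
      rw [← Matrix.mul_assoc, ← Matrix.mul_assoc, hPQ, Matrix.one_mul]) (hPQ i) (hQP i)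
  { num := R.num
    dim := R.dim
    rep := rep
    irreducible := fun i => (e i).some.isIrreducible (R.irreducible i)
    pairwise_inequivalent := fun i j ⟨f⟩ => R.pairwise_inequivalent i j
      ⟨((e i).some.symm.trans f).trans (e j).some⟩
    complete := fun d σ hσ => by
      obtain ⟨i, ⟨f⟩⟩ := R.complete d σ hσ
      exact ⟨i, ⟨f.trans (e i).some.symm⟩⟩ }

end Decomposition

/-! ### Functions on a product of two subgroups -/

section ProductSet

theorem Matrix.sum_smul_mul_mul {X l m n o : Type*} [Fintype X] [Fintype m] [Fintype n]
    (a : X → ℂ) (P : Matrix l m ℂ) (M : X → Matrix m n ℂ) (Q : Matrix n o ℂ) :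
    ∑ x, a x • (P * M x * Q) = P * (∑ x, a x • M x) * Q := by
  rw [Matrix.mul_sum, Matrix.sum_mul]
  simp

theorem Matrix.blockDiagonal'_mul_apply {T n : Type*} [Fintype T] [DecidableEq T] {m : T → Type*}
    [∀ t, Fintype (m t)] (A : ∀ t, Matrix (m t) (m t) ℂ) (S : Matrix (Σ t, m t) n ℂ) (t : T)
    (r : m t) (z : n) :
    (Matrix.blockDiagonal' A * S) ⟨t, r⟩ z = ∑ j, A t r j * S ⟨t, j⟩ z := by
  rw [Matrix.mul_apply, Fintype.sum_sigma, Fintype.sum_eq_single t]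
  · simp [Matrix.blockDiagonal'_apply_eq]
  · intro t' ht'
    exact Finset.sum_eq_zero fun i _ => by
      rw [Matrix.blockDiagonal'_apply_ne _ _ _ ht'.symm, zero_mul]

theorem Matrix.mul_blockDiagonal'_apply {T n : Type*} [Fintype T] [DecidableEq T] {m : T → Type*}
    [∀ t, Fintype (m t)] (A : ∀ t, Matrix (m t) (m t) ℂ) (S : Matrix n (Σ t, m t) ℂ) (t : T)
    (r : m t) (z : n) :
    (S * Matrix.blockDiagonal' A) z ⟨t, r⟩ = ∑ j, S z ⟨t, j⟩ * A t j r := by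
  rw [Matrix.mul_apply, Fintype.sum_sigma, Fintype.sum_eq_single t]
  · simp [Matrix.blockDiagonal'_apply_eq]
  · intro t' ht'
    exact Finset.sum_eq_zero fun i _ => by
      rw [Matrix.blockDiagonal'_apply_ne _ _ _ ht', mul_zero]

theorem sum_smul_blockDiagonal'_apply {X T U : Type*} [Fintype X] [Fintype T] [DecidableEq T]
    [Fintype U] [DecidableEq U] {m : T → Type*} [∀ t, Fintype (m t)] {n : U → Type*}
    [∀ u, Fintype (n u)] (a : X → ℂ) (A : X → ∀ t, Matrix (m t) (m t) ℂ)
    (B : X → ∀ u, Matrix (n u) (n u) ℂ) (S : Matrix (Σ t, m t) (Σ u, n u) ℂ) (t : T) (r : m t)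
    (u : U) (v : n u) :
    (∑ x, a x • (Matrix.blockDiagonal' (A x) * S * Matrix.blockDiagonal' (B x))) ⟨t, r⟩ ⟨u, v⟩ =
      ∑ y : m t × n u, (∑ x, a x * (A x t r y.1 * B x u y.2 v)) * S ⟨t, y.1⟩ ⟨u, y.2⟩ := by
  simp only [Matrix.sum_apply, Matrix.smul_apply, smul_eq_mul, Matrix.mul_blockDiagonal'_apply,
    Matrix.blockDiagonal'_mul_apply, Finset.sum_mul]
  rw [Finset.sum_comm]
  refine Finset.sum_congr rfl fun x _ => ?_
  rw [Finset.sum_comm, ← Fintype.sum_prod_type', Finset.mul_sum]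
  exact Finset.sum_congr rfl fun y _ => by ring

theorem sqrt_rpow_mul {n : ℝ} (hn : 0 < n) (w : ℝ) : n * √n ^ (w - 2) = n ^ (w / 2) := by
  rw [Real.sqrt_eq_rpow, ← Real.rpow_mul hn.le]
  nth_rewrite 1 [← Real.rpow_one n]
  rw [← Real.rpow_add hn]
  congr 1
  ring

variable {b w : ℝ} {G K H : Type*} [Group G] [Fintype G] [Group K] [Fintype K] [Group H] [Fintype H]

theorem card_entries_le (R : IrrSet G) :
    (Fintype.card (Σ i : Fin R.num, Fin (R.dim i) × Fin (R.dim i)) : ℝ) ≤ Fintype.card G := by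
  have := R.sum_dim_sq_le
  simpa [Fintype.card_sigma, sq] using (Nat.cast_le (α := ℝ)).2 this

/-- The two-dimensional transform for `K × H` is done one coordinate at a time. -/
theorem computableWithin_prodDFT (RK : IrrSet K) (RH : IrrSet H) {TK TH : ℝ}
    (hK : ComputableWithin (groupDFT RK) TK) (hH : ComputableWithin (groupDFT RH) TH) :
    ComputableWithin (fun (a : K × H → ℂ) (q : (Σ i : Fin RK.num, Fin (RK.dim i) × Fin (RK.dim i)) ×
        Σ i : Fin RH.num, Fin (RH.dim i) × Fin (RH.dim i)) =>
        ∑ x : K × H, a x * (RK.rep q.1.1 x.1 q.1.2.1 q.1.2.2 * RH.rep q.2.1 x.2 q.2.2.1 q.2.2.2))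
      (Fintype.card H * TK + Fintype.card K * TH) := by
  have first := ComputableWithin.family fun h : H =>
    (ComputableWithin.proj (K := ℂ) fun k : K => (k, h)).comp hK
  have second := ComputableWithin.family
    fun q : Σ i : Fin RK.num, Fin (RK.dim i) × Fin (RK.dim i) =>
      (ComputableWithin.proj (K := ℂ) fun h : H => (h, q)).comp hH
  refine (first.comp second).congr (fun a q => ?_) ?_
  · simp only [groupDFT, Matrix.sum_apply, Matrix.smul_apply, smul_eq_mul, Finset.sum_mul]
    rw [Fintype.sum_prod_type_right]
    exact Finset.sum_congr rfl fun h _ => Finset.sum_congr rfl fun k _ => by ring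
  · simp only [zero_add, Finset.sum_const, Finset.card_univ, nsmul_eq_mul]
    have := hH.nonneg
    have := card_entries_le RK
    gcongr

/-- Let `K` and `H` map to `G`, and let `a` be a function on `K × H`. In bases adapted to `K` on the
left and to `H` on the right, `∑ a (k, h) ρ(k) ρ(h)` becomes `∑ a (k, h) A(k) S B(h)` with block
diagonal `A`, `B` and a constant matrix `S`. Its block for `σ` and `τ` is the image of a block of
`S` under the `(σ, τ)` component of the transform of `a` over `K × H`. -/
theorem computableWithin_productSet
    (hM : ∀ n : ℕ, 1 ≤ n → ComputableWithin (matMulMap n) (b * (n : ℝ) ^ w)) (hw : 2 ≤ w)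
    (φ : K →* G) (ψ : H →* G) (hcard : Fintype.card K * Fintype.card H ≤ Fintype.card G)
    (RG : IrrSet G) (RK : IrrSet K) (RH : IrrSet H) {TK TH : ℝ}
    (hK : ComputableWithin (groupDFT RK) TK) (hH : ComputableWithin (groupDFT RH) TH) :
    ComputableWithin (fun (a : K × H → ℂ) (q : Σ i : Fin RG.num, Fin (RG.dim i) × Fin (RG.dim i)) =>
        (∑ x : K × H, a x • RG.rep q.1 (φ x.1 * ψ x.2)) q.2.1 q.2.2)
      (Fintype.card H * TK + Fintype.card K * TH +
        48 * (b + 1) * (Fintype.card G : ℝ) ^ (w / 2)) := by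
  have hb := matMul_const_nonneg hM
  -- `I i` and `J i` index the summands of the restrictions of the `i`-th representation of `G`.
  choose I _ _ s P Q hPQ hQP hI hσ using fun i => RK.exists_blockDiagonal ((RG.rep i).comp φ)
  choose J _ _ s' P' Q' hPQ' hQP' hJ hτ using fun i => RH.exists_blockDiagonal ((RG.rep i).comp ψ)
  let D : Fin RK.num × Fin RH.num → Type := fun β => Fin (RK.dim β.1) × Fin (RH.dim β.2)
  -- The columns which the block for `σ` and `τ` is applied to are the blocks of `Q i * P' i`, read as
  -- vectors, which link a copy of `σ` and a copy of `τ`.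
  let f : (Σ i : Fin RG.num, I i × J i) → Fin RK.num × Fin RH.num :=
    fun n => (s n.1 n.2.1, s' n.1 n.2.2)
  let W : ∀ n, D (f n) → ℂ := fun n x => (Q n.1 * P' n.1) ⟨n.2.1, x.1⟩ ⟨n.2.2, x.2⟩
  have hcard' : (Fintype.card K : ℝ) * Fintype.card H ≤ Fintype.card G := by exact_mod_cast hcard
  have hs : ∀ β, (Fintype.card (D β) : ℝ) ≤ √(Fintype.card G) := by
    intro β
    rw [Fintype.card_prod, Fintype.card_fin, Fintype.card_fin, Nat.cast_mul]
    calc (RK.dim β.1 : ℝ) * RH.dim β.2 ≤ √(Fintype.card K) * √(Fintype.card H) :=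
          mul_le_mul (RK.dim_le_sqrt _) (RH.dim_le_sqrt _) (Nat.cast_nonneg _) (Real.sqrt_nonneg _)
      _ = √(Fintype.card K * Fintype.card H) := (Real.sqrt_mul (Nat.cast_nonneg _) _).symm
      _ ≤ _ := Real.sqrt_le_sqrt hcard'
  have stage1 := (computableWithin_prodDFT RK RH hK hH).reindex
    fun q : Σ β, D β × D β => (⟨q.1.1, (q.2.1.1, q.2.2.1)⟩, ⟨q.1.2, (q.2.2.2, q.2.1.2)⟩)
  have stage2 := (stage1.comp (computableWithin_blockMul hM hw D D (fun _ => le_rfl) hs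
    f W)).reindex fun q : Σ i, (Σ t, Fin (RK.dim (s i t))) × (Σ t, Fin (RH.dim (s' i t))) =>
      ⟨⟨q.1, (q.2.1.1, q.2.2.1)⟩, (q.2.1.2, q.2.2.2)⟩
  have stage3 := stage2.comp (computableWithin_blockConj hM hw RG.dim RG.dim_le_sqrt hI hJ
    (fun i => Fintype.card_fin _) (fun i => Fintype.card_fin _) P Q')
  refine stage3.congr (fun a q => ?_) ?_
  · obtain ⟨i, k, l⟩ := q
    have hρ : ∀ x : K × H, RG.rep i (φ x.1 * ψ x.2) =
        P i * (Matrix.blockDiagonal' (fun t => RK.rep (s i t) x.1) * (Q i * P' i) *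
          Matrix.blockDiagonal' (fun t => RH.rep (s' i t) x.2)) * Q' i := by
      intro x
      have h1 : RG.rep i (φ x.1) =
          P i * Matrix.blockDiagonal' (fun t => RK.rep (s i t) x.1) * Q i := by
        rw [← hσ i x.1, Matrix.mul_assoc, hPQ, Matrix.mul_one]
        rfl
      have h2 : RG.rep i (ψ x.2) =
          P' i * Matrix.blockDiagonal' (fun t => RH.rep (s' i t) x.2) * Q' i := by
        rw [← hτ i x.2, Matrix.mul_assoc, hPQ', Matrix.mul_one]
        rfl
      rw [map_mul, h1, h2]
      simp only [Matrix.mul_assoc]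
    rw [Finset.sum_congr rfl fun x _ => congrArg (a x • ·) (hρ x), Matrix.sum_smul_mul_mul]
    refine congrFun (congrFun (congrArg (fun X => P i * X * Q' i) ?_) k) l
    ext ⟨t, r⟩ ⟨u, v⟩
    exact (sum_smul_blockDiagonal'_apply a (fun x t => RK.rep (s i t) x.1)
      (fun x t => RH.rep (s' i t) x.2) (Q i * P' i) t r u v).symm
  · have e1 : ∑ β, (Fintype.card (D β) : ℝ) * Fintype.card (D β) ≤ Fintype.card G := by
      refine le_trans (le_of_eq ?_) ((mul_le_mul RK.sum_dim_sq_le_real RH.sum_dim_sq_le_real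
        (by positivity) (by positivity)).trans hcard')
      rw [Finset.sum_mul_sum, ← Fintype.sum_prod_type']
      refine Finset.sum_congr rfl fun β _ => ?_
      simp only [D, Fintype.card_prod, Fintype.card_fin, Nat.cast_mul]
      ring
    have e2 : ∑ n, (Fintype.card (D (f n)) : ℝ) ≤ Fintype.card G := by
      refine le_trans (le_of_eq ?_) RG.sum_dim_sq_le_real
      rw [Fintype.sum_sigma]
      refine Finset.sum_congr rfl fun i _ => ?_
      have h1 : (RG.dim i : ℝ) = ∑ t, (RK.dim (s i t) : ℝ) := by
        rw [← hI i]
        simp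
      have h2 : (RG.dim i : ℝ) = ∑ t, (RH.dim (s' i t) : ℝ) := by
        rw [← hJ i]
        simp
      rw [sq]
      nth_rewrite 1 [h1]
      rw [h2, Finset.sum_mul_sum, ← Fintype.sum_prod_type']
      simp [D, f]
    have e3 := RG.sum_dim_sq_le_real
    rw [← sqrt_rpow_mul (by exact_mod_cast Fintype.card_pos)]
    have h0 : 0 ≤ (b + 1) * √(Fintype.card G : ℝ) ^ (w - 2) := by positivity
    nlinarith [mul_le_mul_of_nonneg_right e1 h0, mul_le_mul_of_nonneg_right e2 h0,
      mul_le_mul_of_nonneg_right e3 h0]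

end ProductSet

/-! ### Extensions with cyclic quotient -/

section CyclicExtension

theorem sum_smul_blockDiagonal'_diagonal_apply {X T Y : Type*} [Fintype X] [Fintype T]
    [DecidableEq T] [Fintype Y] [DecidableEq Y] {m : T → Type*} [∀ t, Fintype (m t)] {p : ℕ}
    (a : X × Fin p → ℂ) (A : X → ∀ t, Matrix (m t) (m t) ℂ) (S : Matrix (Σ t, m t) Y ℂ)
    (l : Y → ℂ) (t : T) (r : m t) (y : Y) (Z : m t → Prop) [Fintype {c // Z c}]
    (hZ : ∀ c, ¬ Z c → S ⟨t, c⟩ y = 0) :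
    (∑ x, a x • (Matrix.blockDiagonal' (A x.1) * S *
        Matrix.diagonal fun y => l y ^ (x.2 : ℕ))) ⟨t, r⟩ y =
      ∑ c : {c // Z c}, (∑ i : Fin p, (∑ n, a (n, i) * A n t r c.1) * l y ^ (i : ℕ)) *
        S ⟨t, c.1⟩ y := by
  simp only [Matrix.sum_apply, Matrix.smul_apply, smul_eq_mul, Matrix.mul_diagonal,
    Matrix.blockDiagonal'_mul_apply]
  rw [Fintype.sum_of_injective (Subtype.val : {c // Z c} → m t) Subtype.val_injective _
    (fun c => (∑ i : Fin p, (∑ n, a (n, i) * A n t r c) * l y ^ (i : ℕ)) * S ⟨t, c⟩ y)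
    (fun c hc => by
      rw [hZ c fun h => hc ⟨⟨c, h⟩, rfl⟩, mul_zero]) fun c => rfl]
  simp only [Finset.sum_mul, Finset.mul_sum]
  rw [Finset.sum_comm]
  refine Finset.sum_congr rfl fun c _ => ?_
  rw [Fintype.sum_prod_type_right]
  exact Finset.sum_congr rfl fun i _ => Finset.sum_congr rfl fun n _ => by ring

variable {b w : ℝ} {G N : Type*} [Group G] [Fintype G] [Group N] [Fintype N]

/-- For functions on `N × {0, …, p - 1}`: the transform over `N`, followed by a Fourier transform
over `i` which, for the column `c` of the representation `σ`, uses the `p`-th roots of `m σ c`. -/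
theorem computableWithin_twistedDFT {p : ℕ} {TN TF : ℝ} {root : ℂ → ℂ} {ζ : ℂ}
    (hF : ∀ μ : ℂ, ComputableWithin (fun (a : Fin p → ℂ) (i : Fin p) =>
      ∑ j, a j * (μ * ζ ^ (i : ℕ)) ^ (j : ℕ)) TF) (RN : IrrSet N)
    (hN : ComputableWithin (groupDFT RN) TN) (m : ∀ i, Fin (RN.dim i) → ℂ) :
    ComputableWithin (fun (a : N × Fin p → ℂ)
        (q : (Σ i : Fin RN.num, Fin (RN.dim i) × Fin (RN.dim i)) × Fin p) =>
        ∑ i : Fin p, (∑ n, a (n, i) * RN.rep q.1.1 n q.1.2.1 q.1.2.2) *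
          (root (m q.1.1 q.1.2.2) * ζ ^ (q.2 : ℕ)) ^ (i : ℕ))
      (p * TN + Fintype.card N * TF) := by
  have first := ComputableWithin.family fun i : Fin p =>
    (ComputableWithin.proj (K := ℂ) fun n : N => (n, i)).comp hN
  have second := ComputableWithin.family
    fun q : Σ i : Fin RN.num, Fin (RN.dim i) × Fin (RN.dim i) =>
      (ComputableWithin.proj (K := ℂ) fun i : Fin p => (i, q)).comp (hF (root (m q.1 q.2.2)))
  refine (first.comp second).congr (fun a q => ?_) ?_
  · simp only [groupDFT, Matrix.sum_apply, Matrix.smul_apply, smul_eq_mul]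
  · simp only [zero_add, Finset.sum_const, Finset.card_univ, nsmul_eq_mul, Fintype.card_fin]
    have := (hF 0).nonneg
    have := card_entries_le RN
    gcongr

theorem exists_root_mul_pow {p : ℕ} (hp : p ≠ 0) {ζ : ℂ} (hζ : IsPrimitiveRoot ζ p) {x y : ℂ}
    (hy : y ≠ 0) (h : x ^ p = y ^ p) : ∃ j : Fin p, x = y * ζ ^ (j : ℕ) := by
  have := NeZero.mk hp
  obtain ⟨j, hj, hxy⟩ := hζ.eq_pow_of_pow_eq_one (ξ := x / y) (by
    rw [div_pow, h, div_self (pow_ne_zero _ hy)])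
  exact ⟨⟨j, hj⟩, by rw [Fin.val_mk, hxy, mul_div_cancel₀ _ hy]⟩

/-- In a basis of eigenvectors of `ρ(g)` on the right and a basis adapted to `N` on the left, every
nonzero entry of the constant matrix `S` links an eigenvector of `σ(g ^ p)` for some `μ` and an
eigenvector of `ρ(g ^ p)` for the same `μ`. -/
theorem apply_eq_zero_of_eigenvalue_ne {T Y : Type*} [Fintype T] [DecidableEq T] [Fintype Y]
    [DecidableEq Y] {dim : T → ℕ} (μ : ∀ t, Fin (dim t) → ℂ)
    (S : Matrix (Σ t, Fin (dim t)) Y ℂ) (l : Y → ℂ)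
    (h : (Matrix.blockDiagonal' fun t => Matrix.diagonal (μ t)) * S = S * Matrix.diagonal l)
    (t : T) (c : Fin (dim t)) (y : Y) (hne : ¬ μ t c = l y) : S ⟨t, c⟩ y = 0 := by
  have h1 := congrFun (congrFun h ⟨t, c⟩) y
  rw [Matrix.blockDiagonal'_mul_apply, Matrix.mul_diagonal, Fintype.sum_eq_single c] at h1
  · rw [Matrix.diagonal_apply_eq, mul_comm, ← sub_eq_zero, ← mul_sub] at h1
    exact (mul_eq_zero.1 h1).resolve_right (sub_ne_zero.2 hne)
  · intro x hx
    rw [Matrix.diagonal_apply_ne _ hx.symm, zero_mul]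

/-- The transform of `G`, when its elements are uniquely `n * g ^ i` with `n ∈ N` and `i < p`. The
matrix `ρ(g)` is made diagonal on the right, and the restriction of `ρ` to `N` block diagonal on the
left. The block for `σ` and for the eigenvalue `l` of `ρ(g)` involves only the columns of `σ` which
belong to the eigenvalue `l ^ p` of `σ(g ^ p)`. -/
theorem computableWithin_cyclicExtension
    (hM : ∀ n : ℕ, 1 ≤ n → ComputableWithin (matMulMap n) (b * (n : ℝ) ^ w)) (hw : 2 ≤ w)
    (φ : N →* G) (g : G) {p : ℕ} (hp : p ≠ 0) (h₀ : N) (hg : φ h₀ = g ^ p)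
    (hbij : Function.Bijective fun x : N × Fin p => φ x.1 * g ^ (x.2 : ℕ)) (RG : IrrSet G)
    (RN : IrrSet N) (m : ∀ i, Fin (RN.dim i) → ℂ) (hm : ∀ i, RN.rep i h₀ = Matrix.diagonal (m i))
    {TN TF : ℝ} (hN : ComputableWithin (groupDFT RN) TN)
    (hF : ∀ μ ζ : ℂ, ζ ≠ 0 → ComputableWithin (fun (a : Fin p → ℂ) (i : Fin p) =>
      ∑ j, a j * (μ * ζ ^ (i : ℕ)) ^ (j : ℕ)) TF) :
    ComputableWithin (groupDFT RG)
      (p * TN + Fintype.card N * TF + 48 * (b + 1) * (Fintype.card G : ℝ) ^ (w / 2)) := by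
  classical
  have hb := matMul_const_nonneg hM
  have hcard : Fintype.card G = p * Fintype.card N := by
    rw [← Fintype.card_of_bijective hbij, Fintype.card_prod, Fintype.card_fin, mul_comm]
  have hζ := Complex.isPrimitiveRoot_exp p hp
  set ζ := Complex.exp (2 * Real.pi * Complex.I / p)
  choose root hroot using fun z : ℂ => IsAlgClosed.exists_pow_nat_eq z (Nat.pos_of_ne_zero hp)
  have hn := (orderOf_pos g).ne'
  set n := orderOf g
  choose I _ _ s P Q hPQ hQP hI hσ using fun i => RN.exists_blockDiagonal ((RG.rep i).comp φ)
  choose P' Q' l hPQ' hQP' hdiag hl using fun i =>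
    exists_diagonalization hn (A := RG.rep i g) (by rw [← map_pow, pow_orderOf_eq_one, map_one])
  have hl0 : ∀ i x, l i x ≠ 0 := fun i x h0 => by
    have := hl i x
    rw [h0, zero_pow hn] at this
    exact zero_ne_one this
  -- A `p`-th root of `μ` is determined by its quotient by the chosen one, a power of `ζ`.
  have hj : ∀ i x, ∃ j : Fin p, l i x = root (l i x ^ p) * ζ ^ (j : ℕ) := fun i x =>
    exists_root_mul_pow hp hζ (fun h0 => hl0 i x (pow_eq_zero_iff hp |>.1 (by
      rw [← hroot (l i x ^ p), h0, zero_pow hp]))) (hroot _).symm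
  choose j hj using hj
  -- The eigenvalues of the matrices `σ(g ^ p)` are `n`-th roots of unity.
  let V := {z : ℂ // z ∈ Polynomial.nthRootsFinset n (1 : ℂ)}
  have hV : ∀ i x, l i x ^ p ∈ Polynomial.nthRootsFinset n (1 : ℂ) := fun i x => by
    rw [Polynomial.mem_nthRootsFinset (Nat.pos_of_ne_zero hn), ← pow_mul, mul_comm, pow_mul, hl,
      one_pow]
  let D : Fin RN.num × V × Fin p → Type := fun β => Fin (RN.dim β.1)
  let E : Fin RN.num × V × Fin p → Type := fun β => {c : Fin (RN.dim β.1) // m β.1 c = β.2.1}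
  let f : (Σ i : Fin RG.num, I i × Fin (RG.dim i)) → Fin RN.num × V × Fin p :=
    fun k => (s k.1 k.2.1, ⟨l k.1 k.2.2 ^ p, hV _ _⟩, j k.1 k.2.2)
  let W : ∀ k, E (f k) → ℂ := fun k x => (Q k.1 * P' k.1) ⟨k.2.1, x.1⟩ k.2.2
  have hED : ∀ β, Fintype.card (E β) ≤ Fintype.card (D β) := fun β => Fintype.card_subtype_le _
  have hs : ∀ β, (Fintype.card (E β) : ℝ) ≤ √(Fintype.card G) := fun β => by
    have h1 : (Fintype.card (E β) : ℝ) ≤ RN.dim β.1 := by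
      have := hED β
      rw [Fintype.card_fin] at this
      exact_mod_cast this
    refine (h1.trans (RN.dim_le_sqrt _)).trans (Real.sqrt_le_sqrt ?_)
    rw [hcard]
    exact_mod_cast Nat.le_mul_of_pos_left _ (Nat.pos_of_ne_zero hp)
  have stage0 := (ComputableWithin.proj (K := ℂ) fun x : N × Fin p => φ x.1 * g ^ (x.2 : ℕ)).comp
    (computableWithin_twistedDFT (root := root) (fun μ => hF μ ζ (hζ.ne_zero hp)) RN hN m)
  have stage1 := stage0.reindex
    fun q : Σ β, D β × E β => (⟨q.1.1, (q.2.1, q.2.2.1)⟩, q.1.2.2)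
  have stage2 := (stage1.comp (computableWithin_blockMul hM hw D E hED hs f W)).reindex
    fun q : Σ i, (Σ t, Fin (RN.dim (s i t))) × Fin (RG.dim i) =>
      ⟨⟨q.1, (q.2.1.1, q.2.2)⟩, q.2.1.2⟩
  have stage3 := stage2.comp (computableWithin_blockConj hM hw RG.dim RG.dim_le_sqrt hI
    (fun i => Fintype.card_fin _) (fun i => Fintype.card_fin _) (fun i => Fintype.card_fin _) P Q')
  refine stage3.congr (fun a q => ?_) ?_
  · obtain ⟨i, k, k'⟩ := q
    have hφ : ∀ x : N, RG.rep i (φ x) =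
        P i * Matrix.blockDiagonal' (fun t => RN.rep (s i t) x) * Q i := fun x => by
      rw [← hσ i x, Matrix.mul_assoc, hPQ, Matrix.mul_one]
      rfl
    have hgpow : ∀ e : ℕ, RG.rep i (g ^ e) =
        P' i * Matrix.diagonal (fun y => l i y ^ e) * Q' i := fun e => by
      rw [← hdiag i e, Matrix.mul_assoc, hPQ', Matrix.mul_one, map_pow]
    have hρ : ∀ x : N × Fin p, RG.rep i (φ x.1 * g ^ (x.2 : ℕ)) =
        P i * (Matrix.blockDiagonal' (fun t => RN.rep (s i t) x.1) * (Q i * P' i) *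
          Matrix.diagonal fun y => l i y ^ (x.2 : ℕ)) * Q' i := fun x => by
      rw [map_mul, hφ, hgpow]
      simp only [Matrix.mul_assoc]
    have hcomm : (Matrix.blockDiagonal' fun t => Matrix.diagonal (m (s i t))) * (Q i * P' i) =
        (Q i * P' i) * Matrix.diagonal fun y => l i y ^ p := by
      have e1 := hgpow p
      rw [← hg, hφ] at e1
      have e2 := congrArg (fun X => Q i * X * P' i) e1
      simp only [Matrix.mul_assoc, hQP', Matrix.mul_one] at e2
      simp only [← Matrix.mul_assoc, hQP, Matrix.one_mul, hm] at e2
      simpa only [← Matrix.mul_assoc] using e2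
    have hsum : ∑ x : N × Fin p, a (φ x.1 * g ^ (x.2 : ℕ)) • RG.rep i (φ x.1 * g ^ (x.2 : ℕ)) =
        ∑ h, a h • RG.rep i h := Fintype.sum_bijective _ hbij _ _ fun _ => rfl
    rw [groupDFT, ← hsum,
      Finset.sum_congr rfl fun x _ => congrArg (a (φ x.1 * g ^ (x.2 : ℕ)) • ·) (hρ x),
      Matrix.sum_smul_mul_mul]
    refine congrFun (congrFun (congrArg (fun X => P i * X * Q' i) ?_) k) k'
    ext ⟨t, r⟩ y
    refine Eq.trans ?_ (sum_smul_blockDiagonal'_diagonal_apply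
      (fun x : N × Fin p => a (φ x.1 * g ^ (x.2 : ℕ))) (fun x t => RN.rep (s i t) x) (Q i * P' i)
      (l i) t r y (fun c => m (s i t) c = l i y ^ p)
      (apply_eq_zero_of_eigenvalue_ne (fun t => m (s i t)) _ _ hcomm t · y)).symm
    change ∑ c : {c // m (s i t) c = l i y ^ p}, (∑ e : Fin p,
      (∑ x, a (φ x * g ^ (e : ℕ)) * RN.rep (s i t) x r c.1) *
        (root (m (s i t) c.1) * ζ ^ (j i y : ℕ)) ^ (e : ℕ)) * (Q i * P' i) ⟨t, c.1⟩ y = _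
    refine Fintype.sum_congr _ _ fun c => ?_
    have hc : root (m (s i t) c.1) * ζ ^ (j i y : ℕ) = l i y :=
      (congrArg (fun z => root z * ζ ^ (j i y : ℕ)) c.2).trans (hj i y).symm
    rw [hc]
  · have hcard' : (Fintype.card G : ℝ) = p * Fintype.card N := by exact_mod_cast hcard
    have e1 : ∑ β, (Fintype.card (D β) : ℝ) * Fintype.card (E β) ≤ Fintype.card G := by
      rw [Fintype.sum_prod_type, hcard']
      refine le_trans ?_ (mul_le_mul_of_nonneg_left RN.sum_dim_sq_le_real (Nat.cast_nonneg p))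
      rw [Finset.mul_sum]
      refine Finset.sum_le_sum fun i _ => ?_
      rw [Fintype.sum_prod_type_right]
      have fibers : ∑ v : V, Fintype.card {c : Fin (RN.dim i) // m i c = v} ≤ RN.dim i := by
        rw [← Fintype.card_sigma]
        refine (Fintype.card_le_of_injective
          (fun x : Σ v : V, {c : Fin (RN.dim i) // m i c = v} => x.2.1) ?_).trans_eq
          (Fintype.card_fin _)
        rintro ⟨⟨v, hv⟩, c, hc⟩ ⟨⟨v', hv'⟩, c', hc'⟩ h
        obtain rfl : c = c' := h
        obtain rfl : m i c = v := hc
        obtain rfl : m i c = v' := hc'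
        rfl
      have fibers' : ∑ v : V, (Fintype.card {c : Fin (RN.dim i) // m i c = v} : ℝ) ≤ RN.dim i := by
        exact_mod_cast fibers
      calc ∑ _x : Fin p, ∑ v : V, (Fintype.card (Fin (RN.dim i)) : ℝ) *
            Fintype.card {c : Fin (RN.dim i) // m i c = v}
          = p * (RN.dim i * ∑ v : V,
            (Fintype.card {c : Fin (RN.dim i) // m i c = v} : ℝ)) := by
            simp [Finset.mul_sum]
        _ ≤ p * (RN.dim i * RN.dim i) := by gcongr
        _ = _ := by ring
    have e2 : ∑ k, (Fintype.card (D (f k)) : ℝ) ≤ Fintype.card G := by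
      refine le_trans (le_of_eq ?_) RG.sum_dim_sq_le_real
      rw [Fintype.sum_sigma]
      refine Finset.sum_congr rfl fun i _ => ?_
      have h1 : (RG.dim i : ℝ) = ∑ t, (RN.dim (s i t) : ℝ) := by
        rw [← hI i]
        simp
      rw [Fintype.sum_prod_type_right, sq]
      simp only [D, f, Fintype.card_fin, Finset.sum_const, Finset.card_univ, nsmul_eq_mul, ← h1]
    have e3 := RG.sum_dim_sq_le_real
    rw [← sqrt_rpow_mul (by exact_mod_cast Fintype.card_pos)]
    have h0 : 0 ≤ (b + 1) * √(Fintype.card G : ℝ) ^ (w - 2) := by positivity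
    nlinarith [mul_le_mul_of_nonneg_right e1 h0, mul_le_mul_of_nonneg_right e2 h0,
      mul_le_mul_of_nonneg_right e3 h0]

end CyclicExtension

/-! ### Solvable groups -/

section Solvable

/-- The trivial group needs no operations at all: every output is the input or `0`. -/
theorem computableWithin_groupDFT_of_subsingleton {G : Type*} [Group G] [Fintype G]
    [Subsingleton G] (R : IrrSet G) : ComputableWithin (groupDFT R) 0 := by
  refine (ComputableWithin.proj_ite (K := ℂ)
    (fun q : Σ i : Fin R.num, Fin (R.dim i) × Fin (R.dim i) => q.2.1 = q.2.2)
    fun _ => (1 : G)).congr (fun c q => ?_) le_rfl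
  rw [groupDFT, Fintype.sum_subsingleton _ (1 : G), map_one, Matrix.smul_apply, Matrix.one_apply,
    smul_eq_mul, mul_ite, mul_one, mul_zero]

/-- Every finite group has a complete set of irreducible representations in which a prescribed
element acts by diagonal matrices. -/
theorem exists_irrSet_diagonal {G : Type*} [Group G] [Fintype G] (h : G) :
    ∃ (R : IrrSet G) (m : ∀ i, Fin (R.dim i) → ℂ), ∀ i, R.rep i h = Matrix.diagonal (m i) := by
  obtain ⟨R⟩ := nonempty_irrSet G
  choose P Q l hPQ hQP hdiag _ using fun i => exists_diagonalization (orderOf_pos h).ne'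
    (A := R.rep i h) (by rw [← map_pow, pow_orderOf_eq_one, map_one])
  have key : ∀ i : Fin R.num, Q i * R.rep i h * P i = Matrix.diagonal (l i) := fun i => ?_
  · exact ⟨R.conj P Q hPQ hQP, l, key⟩
  have := hdiag i 1
  simp only [pow_one] at this
  rw [Matrix.mul_assoc, this, ← Matrix.mul_assoc, hQP, Matrix.one_mul]

/-- A nontrivial finite solvable group `G` has a subgroup `N` and an element `g` such that the
elements of `G` are uniquely `n * g ^ i` with `n ∈ N` and `i < p`, where `p ≥ 2` and `g ^ p ∈ N`. -/
theorem exists_cyclicExtension (G : Type*) [Group G] [Fintype G] [Nontrivial G]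
    [Group.IsSolvable G] :
    ∃ (N : Subgroup G) (g : G) (p : ℕ), 2 ≤ p ∧ g ^ p ∈ N ∧
      Function.Bijective fun x : N × Fin p => (x.1 : G) * g ^ (x.2 : ℕ) := by
  classical
  obtain ⟨N, hN, hcN⟩ := (eq_top_or_exists_le_coatom (commutator G)).resolve_left
    (Group.IsSolvable.commutator_lt_top_of_nontrivial G).ne
  have hnormal : N.Normal := Subgroup.Normal.of_commutator_le G hcN
  obtain ⟨g, hg⟩ : ∃ g, g ∉ N := by
    by_contra! h
    exact hN.1 (Subgroup.eq_top_iff' N |>.2 h)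
  have hgen : N ⊔ Subgroup.zpowers g = ⊤ := by
    refine hN.2 _ (lt_of_le_of_ne le_sup_left fun h => hg ?_)
    rw [h]
    exact Subgroup.mem_sup_right (Subgroup.mem_zpowers g)
  refine ⟨N, g, orderOf (g : G ⧸ N), ?_, ?_, ?_, ?_⟩
  · have h0 := orderOf_pos (g : G ⧸ N)
    have h1 : orderOf (g : G ⧸ N) ≠ 1 := fun h =>
      hg ((QuotientGroup.eq_one_iff g).1 (orderOf_eq_one_iff.1 h))
    omega
  · rw [← QuotientGroup.eq_one_iff, QuotientGroup.mk_pow, pow_orderOf_eq_one]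
  · rintro ⟨n, i⟩ ⟨n', j⟩ h
    have hq := congrArg (QuotientGroup.mk : G → G ⧸ N) h
    simp only [QuotientGroup.mk_mul, QuotientGroup.mk_pow, (QuotientGroup.eq_one_iff _).2 n.2,
      (QuotientGroup.eq_one_iff _).2 n'.2, one_mul] at hq
    have hij : i = j := Fin.ext (pow_injOn_Iio_orderOf i.2 j.2 hq)
    subst hij
    have hn : n = n' := Subtype.ext (mul_right_cancel h)
    rw [hn]
  · intro x
    have hx : x ∈ N ⊔ Subgroup.zpowers g := hgen ▸ Subgroup.mem_top x
    rw [← SetLike.mem_coe, Subgroup.normal_mul] at hx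
    obtain ⟨n, hn, y, ⟨k, rfl⟩, rfl⟩ := hx
    have hk : (g : G ⧸ N) ^ k ∈ Submonoid.powers (g : G ⧸ N) := by
      rw [mem_powers_iff_mem_zpowers]
      exact ⟨k, rfl⟩
    rw [mem_powers_iff_mem_range_orderOf, Finset.mem_image] at hk
    obtain ⟨i, hi, hik⟩ := hk
    rw [Finset.mem_range] at hi
    have hmem : g ^ k * (g ^ i)⁻¹ ∈ N := by
      rw [← QuotientGroup.eq_one_iff, QuotientGroup.mk_mul, QuotientGroup.mk_inv,
        QuotientGroup.mk_pow, QuotientGroup.mk_zpow, hik, mul_inv_cancel]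
    exact ⟨(⟨n * (g ^ k * (g ^ i)⁻¹), N.mul_mem hn hmem⟩, ⟨i, hi⟩), by simp [mul_assoc]⟩

/-- Finite solvable groups have fast transforms. In a cyclic extension with quotient of order
`p ≥ 2`, the `p` transforms of the subgroup take a fraction `p ^ (1 - w / 2)` of the allowed number
of operations, so the cost is dominated by a geometric series. -/
theorem exists_computableWithin_groupDFT_of_isSolvable {b w : ℝ}
    (hM : ∀ n : ℕ, 1 ≤ n → ComputableWithin (matMulMap n) (b * (n : ℝ) ^ w)) (hw : 2 < w) :
    ∃ C : ℝ, 0 ≤ C ∧ ∀ (G : Type*) [Group G] [Fintype G], Group.IsSolvable G → ∀ R : IrrSet G,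
      ComputableWithin (groupDFT R) (C * (Fintype.card G : ℝ) ^ (w / 2)) := by
  have hb := matMul_const_nonneg hM
  set α := w / 2 with hα
  have hα1 : 1 < α := by linarith
  obtain ⟨c, hc0, hc⟩ := exists_computableWithin_fourier hα1
  set θ : ℝ := 2 ^ (1 - α) with hθ
  have hθ1 : θ < 1 := Real.rpow_lt_one_of_one_lt_of_neg one_lt_two (by linarith)
  set C := (c + 48 * (b + 1)) / (1 - θ) with hC
  have hC0 : 0 ≤ C := div_nonneg (by positivity) (by linarith)
  refine ⟨C, hC0, ?_⟩
  have key : ∀ (k : ℕ) (G : Type _) [Group G] [Fintype G], Fintype.card G = k → Group.IsSolvable G →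
      ∀ R : IrrSet G, ComputableWithin (groupDFT R) (C * (Fintype.card G : ℝ) ^ α) := by
    intro k
    induction k using Nat.strong_induction_on with
    | _ k ih =>
    intro G _ _ hk hG R
    rcases subsingleton_or_nontrivial G with h | h
    · exact (computableWithin_groupDFT_of_subsingleton R).mono (by positivity)
    obtain ⟨N, g, p, hp, hgp, hbij⟩ := exists_cyclicExtension G
    have : Fintype N := Fintype.ofFinite N
    have hcard : Fintype.card G = p * Fintype.card N := by
      rw [← Fintype.card_of_bijective hbij, Fintype.card_prod, Fintype.card_fin, mul_comm]
    have hN0 : 0 < Fintype.card N := Fintype.card_pos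
    obtain ⟨RN, m, hm⟩ := exists_irrSet_diagonal (⟨g ^ p, hgp⟩ : N)
    have hN := ih (Fintype.card N) (by rw [← hk, hcard]; nlinarith) N rfl inferInstance RN
    refine (computableWithin_cyclicExtension hM hw.le N.subtype g (by omega) ⟨g ^ p, hgp⟩ rfl hbij R
      RN m hm hN (hc p)).mono ?_
    have hcard' : (Fintype.card G : ℝ) = p * Fintype.card N := by exact_mod_cast hcard
    have hp0 : (0 : ℝ) < p := by positivity
    have hNR : (1 : ℝ) ≤ Fintype.card N := by exact_mod_cast hN0
    have hmul : (Fintype.card G : ℝ) ^ α = (p : ℝ) ^ α * (Fintype.card N : ℝ) ^ α := by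
      rw [hcard', Real.mul_rpow hp0.le (by positivity)]
    have hpθ : (p : ℝ) ≤ θ * (p : ℝ) ^ α := by
      have h1 : (p : ℝ) ^ (1 - α) ≤ θ :=
        Real.rpow_le_rpow_of_nonpos two_pos (by exact_mod_cast hp) (by linarith)
      calc (p : ℝ) = (p : ℝ) ^ (1 - α) * (p : ℝ) ^ α := by
            rw [← Real.rpow_add hp0, sub_add_cancel, Real.rpow_one]
        _ ≤ _ := by gcongr
    have hNα : (Fintype.card N : ℝ) ≤ (Fintype.card N : ℝ) ^ α :=
      Real.self_le_rpow_of_one_le hNR hα1.le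
    calc (p : ℝ) * (C * (Fintype.card N : ℝ) ^ α) + Fintype.card N * (c * (p : ℝ) ^ α) +
          48 * (b + 1) * (Fintype.card G : ℝ) ^ α
        ≤ (θ * (p : ℝ) ^ α) * (C * (Fintype.card N : ℝ) ^ α) +
          (Fintype.card N : ℝ) ^ α * (c * (p : ℝ) ^ α) +
          48 * (b + 1) * (Fintype.card G : ℝ) ^ α := by gcongr
      _ = (θ * C + (c + 48 * (b + 1))) * (Fintype.card G : ℝ) ^ α := by rw [hmul]; ring
      _ = C * (Fintype.card G : ℝ) ^ α := by
        congr 1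
        rw [hC]
        field_simp [(by linarith : (1 - θ) ≠ 0)]
        ring
  exact fun G _ _ => key _ G rfl

end Solvable

/-! ### The exponent of matrix multiplication -/

section Exponent

theorem computableWithin_matMulMap_cubic (n : ℕ) :
    ComputableWithin (matMulMap n) (2 * (n : ℝ) ^ (3 : ℝ)) := by
  have term := fun k : Fin n =>
    (ComputableWithin.proj (K := ℂ) (κ := Fin n × Fin n) (ι := (Fin n × Fin n) ⊕ (Fin n × Fin n))
      fun p => Sum.inl (p.1, k)).zipWith .mul (.proj fun p : Fin n × Fin n => Sum.inr (k, p.2))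
  refine (ComputableWithin.sum Finset.univ fun k _ => term k).congr (fun x p => ?_) (le_of_eq ?_)
  · simp [matMulMap, Matrix.mul_apply, ArithOp.eval]
  · simp only [Finset.sum_const, Finset.card_univ, Fintype.card_prod, Fintype.card_fin,
      nsmul_eq_mul, Nat.cast_mul]
    rw [show (3 : ℝ) = ((3 : ℕ) : ℝ) by norm_num, Real.rpow_natCast]
    ring

/-- The `n ^ 2` entries of a product of matrices are pairwise distinct functions, none of which is
an input or a constant, so they are computed by pairwise distinct gates. -/
theorem sq_le_of_computableWithin_matMulMap {n : ℕ} (hn : 1 ≤ n) {T : ℝ}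
    (h : ComputableWithin (matMulMap n) T) : (n : ℝ) ^ 2 ≤ T := by
  obtain ⟨s, hs, c, out, h⟩ := h
  have hn' : (n : ℂ) ≠ 0 := by exact_mod_cast (by omega : n ≠ 0)
  have hconst : ∀ (z : ℂ) (p : Fin n × Fin n), matMulMap n (fun _ => z) p = n * (z * z) := by
    intro z p
    simp [matMulMap, Matrix.mul_apply]
  have hgate : ∀ p, ∃ j : Fin s, out p = .gate j := by
    intro p
    have h0 := h (fun _ => 0) p
    have h1 := h (fun _ => 1) p
    have h2 := h (fun _ => 2) p
    rw [hconst] at h0 h1 h2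
    generalize out p = o at h0 h1 h2
    cases o with
    | input i =>
      simp only [Operand.eval] at h1 h2
      rw [mul_one, mul_one] at h1
      rw [← h1] at h2
      norm_num at h2
    | const a =>
      simp only [Operand.eval] at h0 h1
      rw [h0, mul_one, mul_one, mul_zero, mul_zero] at h1
      exact absurd h1.symm hn'
    | gate j => exact ⟨j, rfl⟩
  choose j hj using hgate
  have hinj : Function.Injective j := by
    intro p q hpq
    -- On this input, the product is `n` at the entry `p` and `0` elsewhere.
    let x : (Fin n × Fin n) ⊕ (Fin n × Fin n) → ℂ :=
      Sum.elim (fun u => if u.1 = p.1 then 1 else 0) fun u => if u.2 = p.2 then 1 else 0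
    have hx : ∀ r, matMulMap n x r = if r.1 = p.1 ∧ r.2 = p.2 then (n : ℂ) else 0 := by
      intro r
      by_cases h1 : r.1 = p.1 <;> by_cases h2 : r.2 = p.2 <;>
        simp [matMulMap, Matrix.mul_apply, x, h1, h2]
    have e : matMulMap n x p = matMulMap n x q := by rw [← h, ← h, hj, hj, hpq]
    rw [hx, hx, if_pos ⟨rfl, rfl⟩] at e
    by_contra hne
    rw [if_neg fun hq => hne (Prod.ext hq.1 hq.2).symm] at e
    exact hn' e
  have hcard := Fintype.card_le_of_injective j hinj
  rw [Fintype.card_prod, Fintype.card_fin, Fintype.card_fin] at hcard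
  refine le_trans ?_ hs
  rw [sq]
  exact_mod_cast hcard

theorem nonempty_matMulExponents :
    {β : ℝ | ∃ b : ℝ, ∀ n : ℕ, 1 ≤ n →
      ComputableWithin (matMulMap n) (b * (n : ℝ) ^ β)}.Nonempty :=
  ⟨3, 2, fun n _ => computableWithin_matMulMap_cubic n⟩

theorem two_le_matMulExponent : 2 ≤ matMulExponent := by
  refine le_csInf nonempty_matMulExponents ?_
  rintro β ⟨b, hb⟩
  by_contra! hβ
  obtain ⟨x, hx⟩ := ((tendsto_rpow_atTop (by linarith : 0 < 2 - β)).eventually_gt_atTop b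
    |>.and (Filter.eventually_ge_atTop 1)).exists_forall_of_atTop
  obtain ⟨n, hn⟩ := exists_nat_ge x
  obtain ⟨h1, h2⟩ := hx n hn
  have h3 := sq_le_of_computableWithin_matMulMap (by exact_mod_cast h2)
    (hb n (by exact_mod_cast h2))
  have h0 : (0 : ℝ) < n := by linarith
  have h4 : (n : ℝ) ^ 2 = (n : ℝ) ^ (2 - β) * (n : ℝ) ^ β := by
    rw [← Real.rpow_add h0, sub_add_cancel, Real.rpow_two]
  rw [h4] at h3
  exact absurd (le_of_mul_le_mul_right h3 (by positivity)) (not_le.2 h1)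

theorem exists_computableWithin_matMulMap {w : ℝ} (hw : matMulExponent < w) :
    ∃ b : ℝ, ∀ n : ℕ, 1 ≤ n → ComputableWithin (matMulMap n) (b * (n : ℝ) ^ w) := by
  obtain ⟨β, ⟨b, hb⟩, hβ⟩ := exists_lt_of_csInf_lt nonempty_matMulExponents hw
  refine ⟨b, fun n hn => (hb n hn).mono ?_⟩
  have h1 : (1 : ℝ) ≤ n := by exact_mod_cast hn
  have := matMul_const_nonneg hb
  gcongr

end Exponent

/-! ### Covering a group by translates -/

section Covering

variable {G : Type*} [Group G] [Fintype G]

/-- Greedy choice of `t` translates of `X`: by averaging, one of the translates covers at least the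
fraction `|X| / |G|` of any given set. -/
theorem exists_translates [DecidableEq G] (X : Finset G) (t : ℕ) : ∃ γ : Fin t → G,
    (((Finset.univ.filter fun g => ∀ i, (γ i)⁻¹ * g ∉ X).card : ℕ) : ℝ) ≤
      Fintype.card G * (1 - X.card / Fintype.card G : ℝ) ^ t := by
  have hG : (0 : ℝ) < Fintype.card G := by exact_mod_cast Fintype.card_pos
  induction t with
  | zero => exact ⟨Fin.elim0, by simp⟩
  | succ t ih =>
    obtain ⟨γ, hγ⟩ := ih
    set U := Finset.univ.filter fun g => ∀ i, (γ i)⁻¹ * g ∉ X with hU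
    have hsum : ∑ y : G, ((U.filter fun g => y⁻¹ * g ∈ X).card : ℝ) = U.card * X.card := by
      simp only [Finset.card_filter, Nat.cast_sum]
      rw [Finset.sum_comm, Finset.card_eq_sum_ones U, Nat.cast_sum, Finset.sum_mul]
      refine Finset.sum_congr rfl fun u _ => ?_
      rw [← Nat.cast_sum, ← Finset.card_filter, Nat.cast_one, one_mul, Nat.cast_inj]
      refine Finset.card_bij (fun y _ => y⁻¹ * u) (by simp) (by simp) fun x hx =>
        ⟨u * x⁻¹, by simpa using hx, by simp⟩
    obtain ⟨y, -, hy⟩ := Finset.exists_le_of_sum_le (s := Finset.univ)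
      (f := fun _ : G => (U.card * X.card / Fintype.card G : ℝ))
      (g := fun y => ((U.filter fun g => y⁻¹ * g ∈ X).card : ℝ)) Finset.univ_nonempty (by
        rw [hsum, Finset.sum_const, Finset.card_univ, nsmul_eq_mul, mul_div_cancel₀ _ hG.ne'])
    refine ⟨Fin.cons y γ, ?_⟩
    have hsplit : (U.filter fun g => y⁻¹ * g ∈ X).card +
        (Finset.univ.filter fun g =>
          ∀ i, ((Fin.cons y γ : Fin (t + 1) → G) i)⁻¹ * g ∉ X).card = U.card := by
      rw [← Finset.card_filter_add_card_filter_not (s := U) fun g => y⁻¹ * g ∈ X]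
      congr 2
      ext g
      simp [hU, Fin.forall_fin_succ, and_comm]
    have hsplit' : ((U.filter fun g => y⁻¹ * g ∈ X).card : ℝ) +
        ((Finset.univ.filter fun g =>
          ∀ i, ((Fin.cons y γ : Fin (t + 1) → G) i)⁻¹ * g ∉ X).card : ℕ) = U.card := by
      exact_mod_cast hsplit
    have hX : (0 : ℝ) ≤ 1 - X.card / Fintype.card G := by
      rw [sub_nonneg, div_le_one hG]
      exact_mod_cast Finset.card_le_univ X
    calc _ = (U.card : ℝ) - (U.filter fun g => y⁻¹ * g ∈ X).card := by linarith
      _ ≤ U.card - U.card * X.card / Fintype.card G := by linarith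
      _ = U.card * (1 - X.card / Fintype.card G : ℝ) := by ring
      _ ≤ (Fintype.card G * (1 - X.card / Fintype.card G : ℝ) ^ t) *
          (1 - X.card / Fintype.card G : ℝ) := by gcongr
      _ = _ := by ring

/-- Since `(1 - |X| / |G|) ^ t < 1 / |G|` for `t > |G| * log |G| / |X|`, that many greedily chosen
translates of `X` leave no element uncovered. -/
theorem exists_cover (hG : 2 ≤ Fintype.card G) (X : Finset G) (hX : X.Nonempty) :
    ∃ (t : ℕ) (γ : Fin t → G), (∀ g, ∃ i, (γ i)⁻¹ * g ∈ X) ∧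
      (t : ℝ) ≤ 2 * (Fintype.card G * Real.logb 2 (Fintype.card G) / X.card) := by
  classical
  have hG2 : (2 : ℝ) ≤ Fintype.card G := by exact_mod_cast hG
  have hG0 : (0 : ℝ) < Fintype.card G := by linarith
  have hX0 : (0 : ℝ) < X.card := by exact_mod_cast hX.card_pos
  have hXG : (X.card : ℝ) ≤ Fintype.card G := by exact_mod_cast Finset.card_le_univ X
  set n : ℝ := (Fintype.card G : ℝ)
  set r : ℝ := X.card / n with hr
  have hr0 : 0 < r := by positivity
  have hr1 : r ≤ 1 := (div_le_one hG0).2 hXG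
  set t := ⌊Real.log n / r⌋₊ + 1 with ht
  have ht1 : Real.log n / r < t := by
    rw [ht]
    exact_mod_cast Nat.lt_floor_add_one _
  have ht2 : (t : ℝ) ≤ Real.log n / r + 1 := by
    rw [ht]
    push_cast
    have := Nat.floor_le (div_nonneg (Real.log_nonneg (by linarith : 1 ≤ n)) hr0.le)
    linarith
  obtain ⟨γ, hγ⟩ := exists_translates X t
  refine ⟨t, γ, ?_, ?_⟩
  · have hlt : n * (1 - r) ^ t < 1 := by
      calc n * (1 - r) ^ t ≤ n * (Real.exp (-r)) ^ t := by
            have := Real.add_one_le_exp (-r)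
            have : 1 - r ≤ Real.exp (-r) := by linarith
            have : 0 ≤ 1 - r := by linarith
            gcongr
        _ = Real.exp (Real.log n - t * r) := by
            rw [Real.exp_sub, Real.exp_log hG0, ← Real.exp_nat_mul, div_eq_mul_inv, ← Real.exp_neg]
            congr 2
            ring
        _ < 1 := by
            rw [Real.exp_lt_one_iff]
            rw [div_lt_iff₀ hr0] at ht1
            linarith
    have h0 := lt_of_le_of_lt hγ hlt
    have h1 : (Finset.univ.filter fun g => ∀ i, (γ i)⁻¹ * g ∉ X).card = 0 := by
      have : (Finset.univ.filter fun g => ∀ i, (γ i)⁻¹ * g ∉ X).card < 1 := by exact_mod_cast h0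
      omega
    intro g
    by_contra! h
    have : g ∈ Finset.univ.filter fun g => ∀ i, (γ i)⁻¹ * g ∉ X := by simpa using h
    rw [Finset.card_eq_zero.1 h1] at this
    exact absurd this (Finset.notMem_empty g)
  · have hlog2 : 1 ≤ Real.logb 2 n := by
      rw [Real.le_logb_iff_rpow_le one_lt_two hG0, Real.rpow_one]
      exact hG2
    have hlog : Real.log n ≤ Real.logb 2 n := by
      rw [Real.logb, le_div_iff₀ (Real.log_pos one_lt_two)]
      have h1 := Real.log_two_lt_d9
      have h2 := Real.log_nonneg (by linarith : 1 ≤ n)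
      nlinarith
    have e : n * Real.logb 2 n / X.card = Real.logb 2 n / r := by
      rw [hr]
      field_simp
    rw [e]
    have h1 : Real.log n / r ≤ Real.logb 2 n / r := by gcongr
    have h2 : 1 ≤ Real.logb 2 n / r := by
      rw [le_div_iff₀ hr0]
      linarith
    linarith

end Covering

/-! ### Factorizations of groups -/

section Factorization

variable {b w : ℝ} {G K H : Type*} [Group G] [Fintype G] [Group K] [Fintype K] [Group H] [Fintype H]

theorem computableWithin_productSet_rpow
    (hM : ∀ n : ℕ, 1 ≤ n → ComputableWithin (matMulMap n) (b * (n : ℝ) ^ w)) (hw : 2 ≤ w)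
    (φ : K →* G) (ψ : H →* G) (hcard : Fintype.card K * Fintype.card H ≤ Fintype.card G)
    (RG : IrrSet G) {CK CH : ℝ} (hCK : 0 ≤ CK) (hCH : 0 ≤ CH)
    (hK : ∀ R : IrrSet K, ComputableWithin (groupDFT R) (CK * (Fintype.card K : ℝ) ^ (w / 2)))
    (hH : ∀ R : IrrSet H, ComputableWithin (groupDFT R) (CH * (Fintype.card H : ℝ) ^ (w / 2))) :
    ComputableWithin (fun (a : K × H → ℂ) (q : Σ i : Fin RG.num, Fin (RG.dim i) × Fin (RG.dim i)) =>
        (∑ x : K × H, a x • RG.rep q.1 (φ x.1 * ψ x.2)) q.2.1 q.2.2)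
      ((CK + CH + 48 * (b + 1)) * (Fintype.card G : ℝ) ^ (w / 2)) := by
  obtain ⟨RK⟩ := nonempty_irrSet K
  obtain ⟨RH⟩ := nonempty_irrSet H
  refine (computableWithin_productSet hM hw φ ψ hcard RG RK RH (hK RK) (hH RH)).mono ?_
  have hα : 1 ≤ w / 2 := by linarith
  have h1 : (1 : ℝ) ≤ Fintype.card K := by exact_mod_cast Fintype.card_pos
  have h2 : (1 : ℝ) ≤ Fintype.card H := by exact_mod_cast Fintype.card_pos
  have h3 := Real.self_le_rpow_of_one_le h1 hα
  have h4 := Real.self_le_rpow_of_one_le h2 hα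
  have hKH : (Fintype.card K : ℝ) ^ (w / 2) * (Fintype.card H : ℝ) ^ (w / 2) ≤
      (Fintype.card G : ℝ) ^ (w / 2) := by
    rw [← Real.mul_rpow (by positivity) (by positivity)]
    exact Real.rpow_le_rpow (by positivity) (by exact_mod_cast hcard) (by linarith)
  calc (Fintype.card H : ℝ) * (CK * (Fintype.card K : ℝ) ^ (w / 2)) +
        Fintype.card K * (CH * (Fintype.card H : ℝ) ^ (w / 2)) +
        48 * (b + 1) * (Fintype.card G : ℝ) ^ (w / 2)
      ≤ (Fintype.card H : ℝ) ^ (w / 2) * (CK * (Fintype.card K : ℝ) ^ (w / 2)) +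
        (Fintype.card K : ℝ) ^ (w / 2) * (CH * (Fintype.card H : ℝ) ^ (w / 2)) +
        48 * (b + 1) * (Fintype.card G : ℝ) ^ (w / 2) := by gcongr
    _ = (CK + CH) * ((Fintype.card K : ℝ) ^ (w / 2) * (Fintype.card H : ℝ) ^ (w / 2)) +
        48 * (b + 1) * (Fintype.card G : ℝ) ^ (w / 2) := by ring
    _ ≤ (CK + CH) * (Fintype.card G : ℝ) ^ (w / 2) +
        48 * (b + 1) * (Fintype.card G : ℝ) ^ (w / 2) := by gcongr
    _ = _ := by ring

/-- If every element of `G` is uniquely a product of elements of two subgroups, the transform of `G`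
reduces to those of the subgroups. -/
theorem computableWithin_groupDFT_of_bijective
    (hM : ∀ n : ℕ, 1 ≤ n → ComputableWithin (matMulMap n) (b * (n : ℝ) ^ w)) (hw : 2 ≤ w)
    (φ : K →* G) (ψ : H →* G) (hbij : Function.Bijective fun x : K × H => φ x.1 * ψ x.2)
    (RG : IrrSet G) {CK CH : ℝ} (hCK : 0 ≤ CK) (hCH : 0 ≤ CH)
    (hK : ∀ R : IrrSet K, ComputableWithin (groupDFT R) (CK * (Fintype.card K : ℝ) ^ (w / 2)))
    (hH : ∀ R : IrrSet H, ComputableWithin (groupDFT R) (CH * (Fintype.card H : ℝ) ^ (w / 2))) :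
    ComputableWithin (groupDFT RG)
      ((CK + CH + 48 * (b + 1)) * (Fintype.card G : ℝ) ^ (w / 2)) := by
  have hcard : Fintype.card K * Fintype.card H ≤ Fintype.card G := by
    rw [← Fintype.card_of_bijective hbij, Fintype.card_prod]
  refine ((ComputableWithin.proj (K := ℂ) fun x : K × H => φ x.1 * ψ x.2).comp
    (computableWithin_productSet_rpow hM hw φ ψ hcard RG hCK hCH hK hH)).congr
    (fun c q => ?_) (by rw [zero_add])
  have hsum : ∑ x : K × H, c (φ x.1 * ψ x.2) • RG.rep q.1 (φ x.1 * ψ x.2) =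
      ∑ g, c g • RG.rep q.1 g := Fintype.sum_bijective _ hbij _ _ fun _ => rfl
  rw [groupDFT, ← hsum]

/-- If the transform is fast for functions on `X` (here the image of an injection `f`), and `t`
translates of `X` cover `G`, then `t` transforms of functions on `X`, translated and added,
give the transform on `G`. -/
theorem computableWithin_groupDFT_of_cover
    (hM : ∀ n : ℕ, 1 ≤ n → ComputableWithin (matMulMap n) (b * (n : ℝ) ^ w)) (hw : 2 ≤ w)
    {X : Type*} [Fintype X] {f : X → G} (hf : Function.Injective f) {t : ℕ} (γ : Fin t → G)
    (hγ : ∀ g, ∃ i, (γ i)⁻¹ * g ∈ Set.range f) (R : IrrSet G) {T : ℝ}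
    (hX : ComputableWithin (fun (a : X → ℂ) (q : Σ i : Fin R.num, Fin (R.dim i) × Fin (R.dim i)) =>
      (∑ x, a x • R.rep q.1 (f x)) q.2.1 q.2.2) T) :
    ComputableWithin (groupDFT R)
      (t * (T + 33 * (b + 1) * (Fintype.card G : ℝ) ^ (w / 2))) := by
  classical
  have hb := matMul_const_nonneg hM
  choose τ hτ using hγ
  have piece := fun i : Fin t => ((ComputableWithin.proj_ite (K := ℂ)
    (fun x : X => τ (γ i * f x) = i) fun x => γ i * f x).comp hX).comp
    (computableWithin_blockConj hM hw R.dim R.dim_le_sqrt (fun _ => Fintype.card_fin _)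
      (fun _ => Fintype.card_fin _) (fun _ => Fintype.card_fin _) (fun _ => Fintype.card_fin _)
      (fun k => R.rep k (γ i)) fun k => 1)
  refine (ComputableWithin.sum Finset.univ fun i _ => piece i).congr (fun c q => ?_) ?_
  · obtain ⟨k, u, v⟩ := q
    have hpiece : ∀ i, R.rep k (γ i) * (∑ x, (if τ (γ i * f x) = i then c (γ i * f x) else 0) •
        R.rep k (f x)) = ∑ g, if τ g = i then c g • R.rep k g else 0 := by
      intro i
      rw [Finset.mul_sum]
      refine Fintype.sum_of_injective (fun x => γ i * f x)
        ((mul_right_injective (γ i)).comp hf) _ _ (fun g hg => if_neg fun h => hg ?_) fun x => ?_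
      · obtain ⟨x, hx⟩ := hτ g
        exact ⟨x, by simp only [hx, h, mul_inv_cancel_left]⟩
      · by_cases h : τ (γ i * f x) = i <;> simp [h, map_mul]
    have hsum : ∑ g, c g • R.rep k g = ∑ i, R.rep k (γ i) *
        (∑ x, (if τ (γ i * f x) = i then c (γ i * f x) else 0) • R.rep k (f x)) * 1 := by
      simp only [hpiece, mul_one]
      rw [Finset.sum_comm]
      simp
    rw [groupDFT, hsum, Matrix.sum_apply]
    rfl
  · have e1 := R.sum_dim_sq_le_real
    have e2 := card_entries_le R
    have hG : (1 : ℝ) ≤ Fintype.card G := by exact_mod_cast Fintype.card_pos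
    have e3 := Real.self_le_rpow_of_one_le hG (by linarith : 1 ≤ w / 2)
    have e4 := mul_le_mul_of_nonneg_right e1
      (by positivity : 0 ≤ √(Fintype.card G : ℝ) ^ (w - 2))
    rw [sqrt_rpow_mul (by linarith)] at e4
    rw [Finset.sum_const, Finset.card_univ, Fintype.card_fin, nsmul_eq_mul]
    refine mul_le_mul_of_nonneg_left ?_ (Nat.cast_nonneg _)
    have e5 := mul_le_mul_of_nonneg_left e4 (by positivity : 0 ≤ 32 * (b + 1))
    have e6 : 0 ≤ b * (Fintype.card G : ℝ) ^ (w / 2) := by positivity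
    linarith

end Factorization

theorem AbelianOrPGroup.isSolvable {G : Type*} [Group G] [Finite G] {H : Subgroup G}
    (h : AbelianOrPGroup H) : Group.IsSolvable H := by
  rcases h with h | ⟨p, hp, h⟩
  · exact Group.isSolvable_of_comm fun a b => Subtype.ext (h a a.2 b b.2)
  · have := Fact.mk hp
    have := h.isNilpotent
    infer_instance

theorem theorem5p1 :
    ∀ ε : ℝ, 0 < ε → ∃ C : ℝ, ∀ (G : Type*) [Group G] [Fintype G] (H₁ H₂ H₃ : Subgroup G),
      AbelianOrPGroup H₁ → AbelianOrPGroup H₂ → AbelianOrPGroup H₃ →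
      (∃ K : Subgroup G, (K : Set G) = (H₁ : Set G) * (H₂ : Set G)) →
      (H₁ : Set G) ∩ (H₂ : Set G) = {1} →
      ((H₁ : Set G) * (H₂ : Set G)) ∩ (H₃ : Set G) = {1} →
      Nonempty (IrrSet G) ∧ ∀ R : IrrSet G,
        ComputableWithin (groupDFT R)
          (C * ((Nat.card G : ℝ) ^ (matMulExponent / 2 + ε) *
            ((Nat.card G : ℝ) * Real.logb 2 (Nat.card G) /
              ((Nat.card H₁ : ℝ) * (Nat.card H₂ : ℝ) * (Nat.card H₃ : ℝ))))) := by
  classical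
  intro ε hε
  -- The slack `2 * ε` makes `w > 2` even if `ω = 2`, and gives the exponent `w / 2 = ω / 2 + ε`.
  set w := matMulExponent + 2 * ε with hw_def
  have hw : 2 < w := by linarith [two_le_matMulExponent]
  obtain ⟨b, hM⟩ := exists_computableWithin_matMulMap (w := w) (by linarith)
  have hb := matMul_const_nonneg hM
  obtain ⟨C, hC, hsolv⟩ := exists_computableWithin_groupDFT_of_isSolvable hM hw
  refine ⟨2 * (3 * C + 129 * (b + 1)), ?_⟩
  intro G _ _ H₁ H₂ H₃ h₁ h₂ h₃ hK h₁₂ hK₃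
  refine ⟨nonempty_irrSet G, fun R => ?_⟩
  obtain ⟨K, hK⟩ := hK
  rw [← hK] at hK₃
  have hw2 : matMulExponent / 2 + ε = w / 2 := by rw [hw_def]; ring
  rw [hw2, Nat.card_eq_fintype_card]
  rcases subsingleton_or_nontrivial G with hG | hG
  -- For the trivial group the bound is `0`, because of the factor `log |G|`.
  · refine (computableWithin_groupDFT_of_subsingleton R).mono ?_
    rw [Fintype.card_eq_one_iff_nonempty_unique.2 ⟨⟨⟨1⟩, fun _ => Subsingleton.elim _ _⟩⟩]
    simp
  have disj : ∀ {A B : Subgroup G}, (A : Set G) ∩ (B : Set G) = {1} → Disjoint A B := by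
    intro A B h
    rw [Subgroup.disjoint_def]
    intro x hA hB
    exact h.subset ⟨hA, hB⟩
  have inj₁₂ := Subgroup.mul_injective_of_disjoint (disj h₁₂)
  have injK₃ := Subgroup.mul_injective_of_disjoint (disj hK₃)
  have le₁ : H₁ ≤ K := fun x hx => by
    rw [← SetLike.mem_coe, hK]
    exact ⟨x, hx, 1, H₂.one_mem, mul_one x⟩
  have le₂ : H₂ ≤ K := fun x hx => by
    rw [← SetLike.mem_coe, hK]
    exact ⟨1, H₁.one_mem, x, hx, one_mul x⟩
  have bij : Function.Bijective fun x : H₁ × H₂ =>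
      Subgroup.inclusion le₁ x.1 * Subgroup.inclusion le₂ x.2 := by
    refine ⟨fun x y h => inj₁₂ (congrArg Subtype.val h), fun ⟨k, hk⟩ => ?_⟩
    rw [← SetLike.mem_coe, hK] at hk
    obtain ⟨x, hx, y, hy, rfl⟩ := hk
    exact ⟨(⟨x, hx⟩, ⟨y, hy⟩), rfl⟩
  have cardK : Fintype.card K = Fintype.card H₁ * Fintype.card H₂ := by
    rw [← Fintype.card_of_bijective bij, Fintype.card_prod]
  have cardG : Fintype.card K * Fintype.card H₃ ≤ Fintype.card G := by
    rw [← Fintype.card_prod]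
    exact Fintype.card_le_of_injective _ injK₃
  have fastK := fun RK : IrrSet K => computableWithin_groupDFT_of_bijective hM hw.le
    (Subgroup.inclusion le₁) (Subgroup.inclusion le₂) bij RK hC hC (hsolv H₁ h₁.isSolvable)
    (hsolv H₂ h₂.isSolvable)
  have fastX := computableWithin_productSet_rpow hM hw.le K.subtype H₃.subtype cardG R
    (by positivity) hC fastK (hsolv H₃ h₃.isSolvable)
  obtain ⟨t, γ, hγ, ht⟩ := exists_cover Fintype.one_lt_card
    (Finset.univ.image fun x : K × H₃ => (x.1 : G) * x.2) (Finset.univ_nonempty.image _)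
  have fast := computableWithin_groupDFT_of_cover hM hw.le injK₃ γ
    (fun g => by simpa using hγ g) R fastX
  refine fast.mono ?_
  rw [Finset.card_image_of_injective _ injK₃, Finset.card_univ, Fintype.card_prod, cardK,
    Nat.cast_mul, Nat.cast_mul] at ht
  simp only [Nat.card_eq_fintype_card]
  calc _ = (t : ℝ) * ((3 * C + 129 * (b + 1)) * (Fintype.card G : ℝ) ^ (w / 2)) := by ring
    _ ≤ 2 * (Fintype.card G * Real.logb 2 (Fintype.card G) /
        (Fintype.card H₁ * Fintype.card H₂ * Fintype.card H₃)) *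
        ((3 * C + 129 * (b + 1)) * (Fintype.card G : ℝ) ^ (w / 2)) := by gcongr
    _ = _ := by ring
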